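/- Let $p\in\mathbb N$ and let $e_1,\dots,e_p,d_1,\dots,d_p$ be real numbers with $e_j>0$ and $d_j>-p$ for all $j$ and $d_1\cdots d_p=0$. Put $E=\sum_j e_j$, $D=\sum_j d_j$ and assume $$1<\frac{E-D}{p}<p-1$$ (hence $p\ge 3$). For $n\ge 0$ let $$\lambda_n=\prod_{j=1}^p(pn+e_j),\qquad \mu_n=\prod_{j=1}^p(pn+d_j),\qquad a_n=\lambda_n+\mu_n,\qquad b_n=\sqrt{\lambda_n\mu_{n+1}},\qquad b_{-1}=1,$$ and let $P_n$ and $Q_n$ be the polynomials that satisfy $$z r_n(z)=b_n r_{n+1}(z)+a_n r_n(z)+b_{n-1}r_{n-1}(z),\qquad n\ge 0,$$ with $P_{-1}=0,\ P_0=1$ and $Q_{-1}=-1,\ Q_0=0$. Then the associated Stieltjes moment problem is indeterminate of order $1/p$. That is: 1. There is more than one positive measure on $[0,\infty)$ with moments of every order for which the polynomials $P_n$ are orthonormal. 2. For every $z\in\mathbb C$ one has $\sum_n|P_n(z)|^2<\infty$ and $\sum_n|Q_n(z)|^2<\infty$, and the four entries of the Nevanlinna matrix, $$A(z)=z\sum_{k=0}^\infty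 Q_k(0)Q_k(z),\quad B(z)=-1+z\sum_{k=0}^\infty Q_k(0)P_k(z),$$ $$C(z)=1+z\sum_{k=0}^\infty P_k(0)Q_k(z),\quad D(z)=z\sum_{k=0}^\infty P_k(0)P_k(z),$$ are non-constant entire functions, each of order $1/p$, where the order of a non-constant entire function $f$ is $$\rho_f=\limsup_{r\to\infty}\frac{\log\log\max_{|z|=r}|f(z)|}{\log r}.$$ -/

import Mathlib

open Polynomial MeasureTheory Filter

noncomputable section

/-! ### Moment problems given by recurrence coefficients -/

/-- The orthonormal polynomials `P_n` of the moment problem with recurrence coefficients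
`a n`, `b n`: the solution of
`x r_n = b_n r_{n+1} + a_n r_n + b_{n-1} r_{n-1}` (`n ≥ 0`, `b_{-1} = 1`)
with `P_{-1} = 0`, `P_0 = 1`. -/
def orthoP (a b : ℕ → ℝ) : ℕ → ℝ[X]
  | 0 => 1
  | 1 => C (b 0)⁻¹ * (X - C (a 0))
  | n + 2 => C (b (n + 1))⁻¹ *
      ((X - C (a (n + 1))) * orthoP a b (n + 1) - C (b n) * orthoP a b n)

/-- The polynomials of the second kind `Q_n`: the solution of the same recurrence with
`Q_{-1} = -1`, `Q_0 = 0` (so that `Q_1 = 1 / b_0`). -/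
def orthoQ (a b : ℕ → ℝ) : ℕ → ℝ[X]
  | 0 => 0
  | 1 => C (b 0)⁻¹
  | n + 2 => C (b (n + 1))⁻¹ *
      ((X - C (a (n + 1))) * orthoQ a b (n + 1) - C (b n) * orthoQ a b n)

/-- `σ` solves the (normalized) Stieltjes moment problem with recurrence coefficients `a`, `b`:
it is a positive measure supported in `[0, ∞)` with moments of every order for which the
`P_n` are orthonormal. -/
structure IsStieltjesSolution (a b : ℕ → ℝ) (σ : Measure ℝ) : Prop where
  support_nonneg : σ (Set.Iio 0) = 0
  integrable_pow : ∀ n : ℕ, Integrable (fun x : ℝ => x ^ n) σ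
  orthonormal : ∀ m n : ℕ,
    ∫ x, (orthoP a b m).eval x * (orthoP a b n).eval x ∂σ = if m = n then 1 else 0

/-- The Stieltjes moment problem has more than one solution on `[0, ∞)`. -/
def IsIndeterminateStieltjes (a b : ℕ → ℝ) : Prop :=
  ∃ σ τ : Measure ℝ, IsStieltjesSolution a b σ ∧ IsStieltjesSolution a b τ ∧ σ ≠ τ

/-! ### The Nevanlinna matrix -/

/-- `A(z) = z ∑ Q_k(0) Q_k(z)`. -/
def nevanlinnaA (a b : ℕ → ℝ) (z : ℂ) : ℂ :=
  z * ∑' k, aeval (0 : ℂ) (orthoQ a b k) * aeval z (orthoQ a b k)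

/-- `B(z) = -1 + z ∑ Q_k(0) P_k(z)`. -/
def nevanlinnaB (a b : ℕ → ℝ) (z : ℂ) : ℂ :=
  -1 + z * ∑' k, aeval (0 : ℂ) (orthoQ a b k) * aeval z (orthoP a b k)

/-- `C(z) = 1 + z ∑ P_k(0) Q_k(z)`. -/
def nevanlinnaC (a b : ℕ → ℝ) (z : ℂ) : ℂ :=
  1 + z * ∑' k, aeval (0 : ℂ) (orthoP a b k) * aeval z (orthoQ a b k)

/-- `D(z) = z ∑ P_k(0) P_k(z)`. -/
def nevanlinnaD (a b : ℕ → ℝ) (z : ℂ) : ℂ :=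
  z * ∑' k, aeval (0 : ℂ) (orthoP a b k) * aeval z (orthoP a b k)

/-! ### Order of an entire function and of a moment problem -/

/-- The maximum modulus `max_{|z| = r} |f z|`. -/
def maxModulus (f : ℂ → ℂ) (r : ℝ) : ℝ :=
  sSup ((fun z => ‖f z‖) '' Metric.sphere (0 : ℂ) r)

/-- The order `limsup_{r → ∞} log log M_f(r) / log r`, as an extended real number
(meaningful for a non-constant entire function `f`). -/
def entireOrder (f : ℂ → ℂ) : EReal :=
  limsup (fun r : ℝ => ((Real.log (Real.log (maxModulus f r)) / Real.log r : ℝ) : EReal)) atTop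

/-- The sequences `(P_n(z))` and `(Q_n(z))` are square summable for every complex `z` (so
the series in the Nevanlinna matrix converge absolutely), the four functions `A`, `B`, `C`, `D`
are non-constant entire functions, and their common order is `ρ`. -/
structure HasNevanlinnaOrder (a b : ℕ → ℝ) (ρ : ℝ) : Prop where
  summable_P : ∀ z : ℂ, Summable fun n => ‖aeval z (orthoP a b n)‖ ^ 2
  summable_Q : ∀ z : ℂ, Summable fun n => ‖aeval z (orthoQ a b n)‖ ^ 2
  order_eq : ∀ f ∈ ({nevanlinnaA a b, nevanlinnaB a b, nevanlinnaC a b, nevanlinnaD a b} :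
      Set (ℂ → ℂ)),
    Differentiable ℂ f ∧ (¬ ∃ c : ℂ, ∀ z, f z = c) ∧ entireOrder f = (ρ : EReal)

/-! ### Birth and death rates -/

/-- The recurrence coefficients `a_n = λ_n + μ_n` of the Stieltjes problem of a birth and death
process with birth rates `lam` and death rates `mu`. -/
def birthDeathA (lam mu : ℕ → ℝ) (n : ℕ) : ℝ := lam n + mu n

/-- The recurrence coefficients `b_n = √(λ_n μ_{n+1})`. -/
def birthDeathB (lam mu : ℕ → ℝ) (n : ℕ) : ℝ := Real.sqrt (lam n * mu (n + 1))

/-- The polynomial rate `n ↦ (p n + c_1) ⋯ (p n + c_p)`. -/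
def polyRate (p : ℕ) (c : Fin p → ℝ) (n : ℕ) : ℝ := ∏ j, ((p : ℝ) * n + c j)

end

/-! Write π_n = λ_0⋯λ_{n-1}/(μ_1⋯μ_n), l_n = 1/(λ_n π_n), α = (E-D)/p and β = p - α. Gamma
asymptotics show that π_n has size n^{-β} and l_n has size n^{-α}, so the hypothesis says exactly
that α and β exceed 1, that is, that both series converge. Everything is read off a discrete string
with masses π_n and lengths l_n.

Indeterminacy (`isIndeterminateStieltjes_birthDeath`): as μ_0 = 0, the vector ξ_n = P_n(0) = (-1)^n
√π_n is annihilated by the Jacobi matrix, and it lies in ℓ². Let X_j be its truncations. Then S = ∑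
l_j X_j ⊗ X_j is a compact positive right inverse of the Jacobi matrix on finite vectors, and so is
S + c ξ ⊗ ξ for every c ≥ 0. The eigenvectors of such an operator yield a solution whose integral of
1/x is its (0,0) entry (`exists_isStieltjesSolution`), so c = 0 and c = 1 give different solutions.

Order (`hasNevanlinnaOrder_birthDeath`): P_n(z) and Q_n(z) are, up to sign, √π_n times string
displacements y_n(z), so each Nevanlinna entry is a constant plus or minus z ∑ w_k y_k(z) with
nonnegative weights. For |z| ≤ r about N = r^{1/p} steps matter: each costs at most a power of r,
and all later ones together only e^{O(N)}, so log|y_n| is O(r^{1/p} log r)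
(`exists_norm_stringSol_le`). At z = -r everything is nonnegative and the displacement doubles while
r l_n π_n = r/λ_n ≥ 1, again for about r^{1/p} steps (`two_pow_mul_le_stringSol`). The factor log r
is invisible to the order. -/

/-! ### Spectral measures from compact right inverses of a Jacobi matrix. -/

section SpectralMeasure

open Module.End

variable {E : Type*} [NormedAddCommGroup E] [InnerProductSpace ℝ E]

/-- Eigenvectors of a symmetric right inverse of a Jacobi matrix are given by the orthonormal
polynomials. -/
lemma inner_eigenvector_eq_orthoP {a b : ℕ → ℝ} (hb : ∀ n, b n ≠ 0) {T : E →L[ℝ] E}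
    (hT : T.IsSymmetric) {e : ℕ → E} (h0 : T (a 0 • e 0 + b 0 • e 1) = e 0)
    (h1 : ∀ n, T (b n • e n + a (n + 1) • e (n + 1) + b (n + 1) • e (n + 2)) = e (n + 1))
    {t : ℝ} (ht : t ≠ 0) {v : E} (hv : T v = t • v) (n : ℕ) :
    inner ℝ v (e n) = (orthoP a b n).eval t⁻¹ * inner ℝ v (e 0) := by
  have key : ∀ u, inner ℝ v u = t⁻¹ * inner ℝ v (T u) := fun u => by
    have : inner ℝ (T v) u = inner ℝ v (T u) := hT v u
    rw [← this, hv, real_inner_smul_left, inv_mul_cancel_left₀ ht]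
  have k0 := key (a 0 • e 0 + b 0 • e 1)
  have k1 := fun n => key (b n • e n + a (n + 1) • e (n + 1) + b (n + 1) • e (n + 2))
  rw [h0] at k0
  simp only [h1] at k1
  simp only [inner_add_right, real_inner_smul_right] at k0 k1
  induction n using Nat.twoStepInduction with
  | zero => simp [orthoP]
  | one =>
    have := hb 0
    simp only [orthoP, eval_mul, eval_C, eval_sub, eval_X]
    rw [mul_assoc, eq_inv_mul_iff_mul_eq₀ this]
    linarith
  | more n ih1 ih2 =>
    have := hb (n + 1)
    simp only [orthoP, eval_mul, eval_C, eval_sub, eval_X]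
    rw [mul_assoc, eq_inv_mul_iff_mul_eq₀ this, sub_mul, mul_assoc, mul_assoc, ← ih1, ← ih2]
    linarith [k1 n]

variable [CompleteSpace E]

/-- A compact positive right inverse of a Jacobi matrix has a Hilbert basis of eigenvectors with
positive eigenvalues, none of them orthogonal to the first basis vector. -/
lemma exists_hilbertBasis_eigenvectors {a b : ℕ → ℝ} (hb : ∀ n, b n ≠ 0) {T : E →L[ℝ] E}
    (hc : IsCompactOperator T) (hT : T.IsSymmetric) (hpos : ∀ x, 0 ≤ inner ℝ x (T x))
    (e : HilbertBasis ℕ ℝ E) (h0 : T (a 0 • e 0 + b 0 • e 1) = e 0)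
    (h1 : ∀ n, T (b n • e n + a (n + 1) • e (n + 1) + b (n + 1) • e (n + 2)) = e (n + 1)) :
    ∃ (ι : Type) (φ : HilbertBasis ι ℝ E) (t : ι → ℝ), Countable ι ∧
      ∀ i, 0 < t i ∧ T (φ i) = t i • φ i := by
  -- By symmetry the kernel is orthogonal to the range, which contains every `e n`.
  have hinj : ∀ v, T v = 0 → v = 0 := by
    intro v hv
    have key : ∀ u, inner ℝ v (T u) = 0 := fun u => by
      have : inner ℝ (T v) u = inner ℝ v (T u) := hT v u
      rw [← this, hv, inner_zero_left]
    have hz : ∀ n, inner ℝ (e n) v = 0 := by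
      intro n
      rw [real_inner_comm]
      cases n with
      | zero => rw [← h0]; exact key _
      | succ n => rw [← h1]; exact key _
    apply e.repr.injective
    ext n
    simp [e.repr_apply_apply, hz]
  -- All coordinates of an eigenvector are multiples of its zeroth one. Hence eigenspaces are
  -- one-dimensional, and one unit vector per eigenvalue suffices for a basis.
  have hker : ∀ {t : ℝ} {v : E}, T v = t • v → inner ℝ v (e 0) = 0 → v = 0 := by
    intro t v hv h
    rcases eq_or_ne t 0 with rfl | ht
    · exact hinj v (by simpa using hv)
    · apply e.repr.injective
      ext n
      rw [e.repr_apply_apply, real_inner_comm,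
        inner_eigenvector_eq_orthoP hb hT h0 h1 ht hv n, h]
      simp
  let ι := {t : ℝ // HasEigenvalue (T : Module.End ℝ E) t}
  have hex : ∀ i : ι, ∃ v : E, ‖v‖ = 1 ∧ T v = i.1 • v := by
    intro i
    obtain ⟨v, hv⟩ := i.2.exists_hasEigenvector
    have hv0 : ‖v‖ ≠ 0 := norm_ne_zero_iff.2 hv.2
    refine ⟨‖v‖⁻¹ • v, ?_, ?_⟩
    · rw [norm_smul, norm_inv, norm_norm, inv_mul_cancel₀ hv0]
    · have : T v = i.1 • v := hv.apply_eq_smul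
      rw [map_smul, this, smul_comm]
  choose v hv1 hv2 using hex
  have horth : Orthonormal ℝ v := by
    refine ⟨hv1, fun i j hij => ?_⟩
    have h : inner ℝ (T (v i)) (v j) = inner ℝ (v i) (T (v j)) := hT _ _
    rw [hv2, hv2, real_inner_smul_left, real_inner_smul_right] at h
    have hne : i.1 - j.1 ≠ 0 := sub_ne_zero.2 fun h => hij (Subtype.ext h)
    exact (mul_eq_zero.1 (by linarith : (i.1 - j.1) * inner ℝ (v i) (v j) = 0)).resolve_left hne
  have hspan : (Submodule.span ℝ (Set.range v))ᗮ = ⊥ := by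
    rw [eq_bot_iff, ← ContinuousLinearMap.orthogonalComplement_iSup_eigenspaces_eq_bot hc hT]
    refine Submodule.orthogonal_le (iSup_le fun t w hw => ?_)
    have hw' : T w = t • w := mem_eigenspace_iff.1 hw
    rcases eq_or_ne w 0 with rfl | hw0
    · exact Submodule.zero_mem _
    let i : ι := ⟨t, hasEigenvalue_of_hasEigenvector ⟨hw, hw0⟩⟩
    have hi : inner ℝ (v i) (e 0) ≠ 0 := fun h => by
      have := hker (hv2 i) h
      have h2 := hv1 i
      rw [this, norm_zero] at h2
      exact zero_ne_one h2
    have hz : inner ℝ (v i) (e 0) • w - inner ℝ w (e 0) • v i = 0 := by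
      refine hker (t := t) ?_ ?_
      · rw [map_sub, map_smul, map_smul, hw', hv2 i, smul_sub, smul_comm t, smul_comm t]
      · rw [inner_sub_left, real_inner_smul_left, real_inner_smul_left]; ring
    have : w = (inner ℝ (v i) (e 0))⁻¹ • inner ℝ w (e 0) • v i := by
      rw [← sub_eq_zero.1 hz, inv_smul_smul₀ hi]
    rw [this]
    exact Submodule.smul_mem _ _ (Submodule.smul_mem _ _ (Submodule.subset_span ⟨i, rfl⟩))
  let φ : HilbertBasis ι ℝ E := HilbertBasis.mkOfOrthogonalEqBot horth hspan
  have hφ : ∀ i, φ i = v i := fun i => by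
    simp [φ]
  refine ⟨ι, φ, fun i => i.1, ?_, fun i => ⟨?_, ?_⟩⟩
  -- A summable family has countable support, and here no term vanishes.
  · have hs := (φ.summable_inner_mul_inner (e 0) (e 0)).countable_support
    have : (Function.support fun i => inner ℝ (e 0) (φ i) * inner ℝ (φ i) (e 0)) = Set.univ := by
      refine Set.eq_univ_of_forall fun i => ?_
      have hi : inner ℝ (v i) (e 0) ≠ 0 := fun h => by
        have := hker (hv2 i) h
        have h2 := hv1 i
        rw [this, norm_zero] at h2
        exact zero_ne_one h2
      rw [Function.mem_support, hφ, real_inner_comm]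
      exact mul_ne_zero hi hi
    rw [this] at hs
    exact Set.countable_univ_iff.1 hs
  · have h := hpos (v i)
    rw [hv2, real_inner_smul_right, real_inner_self_eq_norm_sq, hv1] at h
    refine lt_of_le_of_ne (by simpa using h) fun h0 => ?_
    have h3 : i.1 = 0 := h0.symm
    have h2 := hv1 i
    rw [hinj (v i) (by rw [hv2, h3, zero_smul]), norm_zero] at h2
    exact zero_ne_one h2
  · rw [hφ]; exact hv2 i

/-- A compact positive right inverse of a Jacobi matrix gives a solution of the Stieltjes moment
problem. -/
lemma exists_isStieltjesSolution {a b : ℕ → ℝ} (hb : ∀ n, b n ≠ 0) {T : E →L[ℝ] E}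
    (hc : IsCompactOperator T) (hT : T.IsSymmetric) (hpos : ∀ x, 0 ≤ inner ℝ x (T x))
    (e : HilbertBasis ℕ ℝ E) (h0 : T (a 0 • e 0 + b 0 • e 1) = e 0)
    (h1 : ∀ n, T (b n • e n + a (n + 1) • e (n + 1) + b (n + 1) • e (n + 2)) = e (n + 1)) :
    ∃ σ : Measure ℝ, IsStieltjesSolution a b σ ∧ ∫ x, x⁻¹ ∂σ = inner ℝ (e 0) (T (e 0)) := by
  obtain ⟨ι, φ, t, hι, ht⟩ := exists_hilbertBasis_eigenvectors hb hc hT hpos e h0 h1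
  have hP : ∀ n i, inner ℝ (φ i) (e n) = (orthoP a b n).eval (t i)⁻¹ * inner ℝ (φ i) (e 0) :=
    fun n i => inner_eigenvector_eq_orthoP hb hT h0 h1 (ht i).1.ne' (ht i).2 n
  have hTφ : ∀ i u, inner ℝ (φ i) (T u) = t i * inner ℝ (φ i) u := fun i u => by
    have : inner ℝ (T (φ i)) u = inner ℝ (φ i) (T u) := hT _ _
    rw [← this, (ht i).2, real_inner_smul_left]
  have hsum : ∀ x y : E, HasSum (fun i => inner ℝ (φ i) x * inner ℝ (φ i) y) (inner ℝ x y) :=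
    fun x y => by simpa only [real_inner_comm] using φ.hasSum_inner_mul_inner x y
  have hpre : ∀ w ∈ Submodule.span ℝ (Set.range e), ∃ u ∈ Submodule.span ℝ (Set.range e),
      T u = w := by
    intro w hw
    have he : ∀ n, e n ∈ Submodule.span ℝ (Set.range e) := fun n => Submodule.subset_span ⟨n, rfl⟩
    induction hw using Submodule.span_induction with
    | mem x hx =>
      obtain ⟨n, rfl⟩ := hx
      cases n with
      | zero =>
        exact ⟨_, Submodule.add_mem _ (Submodule.smul_mem _ _ (he _))
          (Submodule.smul_mem _ _ (he _)), h0⟩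
      | succ n =>
        exact ⟨_, Submodule.add_mem _ (Submodule.add_mem _ (Submodule.smul_mem _ _ (he _))
          (Submodule.smul_mem _ _ (he _))) (Submodule.smul_mem _ _ (he _)), h1 n⟩
    | zero => exact ⟨0, Submodule.zero_mem _, map_zero _⟩
    | add x y _ _ hx hy =>
      obtain ⟨u, hu, rfl⟩ := hx
      obtain ⟨u', hu', rfl⟩ := hy
      exact ⟨u + u', Submodule.add_mem _ hu hu', map_add _ _ _⟩
    | smul c x _ hx =>
      obtain ⟨u, hu, rfl⟩ := hx
      exact ⟨c • u, Submodule.smul_mem _ _ hu, map_smul _ _ _⟩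
  -- The vector `u` plays the role of the n-th power of the Jacobi matrix applied to `e 0`; it makes
  -- the n-th moment an inner product, hence finite.
  have hpow : ∀ n : ℕ, ∃ u ∈ Submodule.span ℝ (Set.range e),
      ∀ i, inner ℝ (φ i) u = (t i)⁻¹ ^ n * inner ℝ (φ i) (e 0) := by
    intro n
    induction n with
    | zero => exact ⟨e 0, Submodule.subset_span ⟨0, rfl⟩, by simp⟩
    | succ n ih =>
      obtain ⟨w, hw, hw'⟩ := ih
      obtain ⟨u, hu, rfl⟩ := hpre w hw
      refine ⟨u, hu, fun i => ?_⟩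
      have := hw' i
      rw [hTφ, mul_comm, ← eq_mul_inv_iff_mul_eq₀ (ht i).1.ne'] at this
      rw [this]; ring
  let c : ι → ENNReal := fun i => ENNReal.ofReal (inner ℝ (φ i) (e 0) ^ 2)
  have hcr : ∀ i, (c i).toReal = inner ℝ (φ i) (e 0) ^ 2 := fun i =>
    ENNReal.toReal_ofReal (sq_nonneg _)
  have hct : ∀ i, c i ≠ ⊤ := fun i => ENNReal.ofReal_ne_top
  -- The spectral measure of `e 0` for the inverse of `T`: atoms at the reciprocals of the
  -- eigenvalues.
  refine ⟨Measure.sum fun i => c i • Measure.dirac (t i)⁻¹, ⟨?_, ?_, ?_⟩, ?_⟩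
  · rw [Measure.sum_apply _ measurableSet_Iio]
    refine ENNReal.tsum_eq_zero.2 fun i => ?_
    simp [(ht i).1.le]
  · intro n
    refine integrable_sum_dirac hct ?_
    obtain ⟨u, -, hu⟩ := hpow n
    refine (hsum (e 0) u).summable.congr fun i => ?_
    rw [hu, hcr, Real.norm_of_nonneg (pow_nonneg (inv_nonneg.2 (ht i).1.le) _)]
    ring
  · intro m n
    rw [integral_sum_dirac hct]
    have hon : inner ℝ (e m) (e n) = if m = n then (1 : ℝ) else 0 :=
      orthonormal_iff_ite.1 e.orthonormal m n
    rw [← hon, ← (hsum (e m) (e n)).tsum_eq]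
    congr 1; ext i
    rw [hP m, hP n, hcr, smul_eq_mul]
    ring
  · rw [integral_sum_dirac hct, ← (hsum (e 0) (T (e 0))).tsum_eq]
    congr 1; ext i
    rw [hTφ, hcr, inv_inv, smul_eq_mul]
    ring

end SpectralMeasure

/-! ### Indeterminacy from a square-summable kernel vector. -/

section Indeterminate

lemma isCompactOperator_rankOne {E : Type*} [NormedAddCommGroup E] [InnerProductSpace ℝ E]
    (x y : E) : IsCompactOperator (InnerProductSpace.rankOne ℝ x y) := by
  refine ⟨(fun c : ℝ => c • x) '' Metric.closedBall 0 ‖y‖,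
    (isCompact_closedBall _ _).image (by fun_prop), ?_⟩
  filter_upwards [Metric.closedBall_mem_nhds (0 : E) one_pos] with z hz
  refine ⟨inner ℝ y z, ?_, rfl⟩
  rw [mem_closedBall_zero_iff] at hz ⊢
  calc ‖inner ℝ y z‖ ≤ ‖y‖ * ‖z‖ := norm_inner_le_norm _ _
    _ ≤ ‖y‖ * 1 := by gcongr
    _ = ‖y‖ := mul_one _

/-- The kernel vector `x` is orthogonal to every column of the Jacobi matrix, so a right inverse
stays one after adding a multiple of the projection-like operator x ⊗ x. The freedom in that
multiple is the indeterminacy. -/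
lemma isIndeterminateStieltjes_of_hilbertBasis {E : Type*} [NormedAddCommGroup E]
    [InnerProductSpace ℝ E] [CompleteSpace E] {a b ξ l : ℕ → ℝ} (hb : ∀ n, b n ≠ 0)
    (hξ0 : a 0 * ξ 0 + b 0 * ξ 1 = 0)
    (hξ : ∀ n, b n * ξ n + a (n + 1) * ξ (n + 1) + b (n + 1) * ξ (n + 2) = 0)
    (hξ1 : ξ 0 = 1) (hl : ∀ n, 0 ≤ l n) (hlξ : ∀ n, l n * b n * ξ n * ξ (n + 1) = -1)
    (hξs : Summable fun n => ξ n ^ 2) (hls : Summable l)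
    (e : HilbertBasis ℕ ℝ E) (x : E) (hx : ∀ n, inner ℝ x (e n) = ξ n) :
    IsIndeterminateStieltjes a b := by
  have hee : ∀ m n, inner ℝ (e m) (e n) = if m = n then (1 : ℝ) else 0 :=
    orthonormal_iff_ite.1 e.orthonormal
  let X : ℕ → E := fun j => ∑ k ∈ Finset.range (j + 1), ξ k • e k
  have hX : ∀ j n, inner ℝ (X j) (e n) = if n ≤ j then ξ n else 0 := fun j n => by
    simp only [X, sum_inner, real_inner_smul_left, hee, mul_ite, mul_one, mul_zero,
      Finset.sum_ite_eq', Finset.mem_range, Nat.lt_succ_iff]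
  have hXn : ∀ j, ‖X j‖ * ‖X j‖ ≤ ∑' n, ξ n ^ 2 := fun j => by
    rw [← real_inner_self_eq_norm_mul_norm]
    change inner ℝ (X j) (∑ k ∈ Finset.range (j + 1), ξ k • e k) ≤ _
    rw [inner_sum]
    simp only [real_inner_smul_right, hX]
    refine le_trans (le_of_eq (Finset.sum_congr rfl fun k hk => ?_))
      (hξs.sum_le_tsum (Finset.range (j + 1)) fun _ _ => sq_nonneg _)
    rw [if_pos (Nat.lt_succ_iff.1 (Finset.mem_range.1 hk)), sq]
  let R : E → E →L[ℝ] E := fun u => InnerProductSpace.rankOne ℝ u u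
  have hsum : Summable fun j => l j • R (X j) := by
    refine Summable.of_norm_bounded (hls.mul_right (∑' n, ξ n ^ 2)) fun j => ?_
    rw [norm_smul, Real.norm_of_nonneg (hl j), InnerProductSpace.norm_rankOne]
    exact mul_le_mul_of_nonneg_left (hXn j) (hl j)
  let S : E →L[ℝ] E := ∑' j, l j • R (X j)
  have hSs : HasSum (fun j => l j • R (X j)) S := hsum.hasSum
  have hSu : ∀ u, HasSum (fun j => (l j * inner ℝ (X j) u) • X j) (S u) := fun u => by
    have := (ContinuousLinearMap.apply ℝ E u).hasSum hSs
    simpa [R, smul_smul] using this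
  have hSuv : ∀ u v, HasSum (fun j => l j * (inner ℝ (X j) u * inner ℝ (X j) v))
      (inner ℝ v (S u)) := fun u v => by
    have := (innerSL ℝ v).hasSum (hSu u)
    simpa [real_inner_smul_right, real_inner_comm, mul_assoc] using this
  have hRc : ∀ u, IsCompactOperator (R u) := fun u => isCompactOperator_rankOne u u
  have hSc : IsCompactOperator S := by
    refine isCompactOperator_of_tendsto hSs (Eventually.of_forall fun s => ?_)
    exact (compactOperator (RingHom.id ℝ) E E).sum_mem fun j _ =>
      (compactOperator (RingHom.id ℝ) E E).smul_mem (l j) (hRc (X j))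
  let T : ℝ → E →L[ℝ] E := fun c => c • R x + S
  have hTu : ∀ c u, T c u = c • inner ℝ x u • x + S u := fun c u => rfl
  have hTuv : ∀ c u v, inner ℝ v (T c u) = c * (inner ℝ x u * inner ℝ x v) + inner ℝ v (S u) :=
    fun c u v => by
      rw [hTu, inner_add_right, real_inner_smul_right, real_inner_smul_right, real_inner_comm v]
  have hTc : ∀ c, IsCompactOperator (T c) := fun c => ((hRc x).smul c).add hSc
  have hTsymm : ∀ c, (T c).IsSymmetric := fun c u v => by
    change inner ℝ (T c u) v = inner ℝ u (T c v)
    rw [real_inner_comm, hTuv, hTuv, ← (hSuv u v).tsum_eq, ← (hSuv v u).tsum_eq]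
    simp only [mul_comm]
  have hTpos : ∀ c, 0 ≤ c → ∀ u, 0 ≤ inner ℝ u (T c u) := fun c hc u => by
    rw [hTuv]
    exact add_nonneg (mul_nonneg hc (mul_self_nonneg _))
      ((hSuv u u).nonneg fun j => mul_nonneg (hl j) (mul_self_nonneg _))
  have hT0 : ∀ c, T c (a 0 • e 0 + b 0 • e 1) = e 0 := fun c => by
    have h := hSu (a 0 • e 0 + b 0 • e 1)
    -- A truncation containing both coordinates of the column pairs to zero with it by the kernel
    -- equation, so only j = 0 contributes.
    have h2 : HasSum (fun j => (l j * inner ℝ (X j) (a 0 • e 0 + b 0 • e 1)) • X j) (e 0) := by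
      convert hasSum_single (0 : ℕ) ?_ using 1
      · have h3 : X 0 = e 0 := by simp [X, hξ1]
        simp only [inner_add_right, real_inner_smul_right, hX]
        have := hlξ 0
        simp only [hξ1, mul_one, zero_add] at this hξ0
        rw [if_pos le_rfl, if_neg (by omega), h3, hξ1, mul_one, mul_zero, add_zero,
          show l 0 * a 0 = 1 by linear_combination l 0 * hξ0 - this, one_smul]
      · intro j hj
        simp only [inner_add_right, real_inner_smul_right, hX]
        rw [if_pos (Nat.zero_le _), if_pos (Nat.one_le_iff_ne_zero.2 hj), hξ0, mul_zero, zero_smul]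
    rw [hTu, h.unique h2, inner_add_right, real_inner_smul_right, real_inner_smul_right, hx, hx,
      hξ0, zero_smul, smul_zero, zero_add]
  have hT1 : ∀ c n,
      T c (b n • e n + a (n + 1) • e (n + 1) + b (n + 1) • e (n + 2)) = e (n + 1) := fun c n => by
    set u := b n • e n + a (n + 1) • e (n + 1) + b (n + 1) • e (n + 2) with hu
    have hXu : ∀ j, inner ℝ (X j) u = b n * (if n ≤ j then ξ n else 0) +
        a (n + 1) * (if n + 1 ≤ j then ξ (n + 1) else 0) +
        b (n + 1) * (if n + 2 ≤ j then ξ (n + 2) else 0) := fun j => by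
      simp only [hu, inner_add_right, real_inner_smul_right, hX]
    have h2 : HasSum (fun j => (l j * inner ℝ (X j) u) • X j) (e (n + 1)) := by
      have hz : ∀ j ∉ ({n, n + 1} : Finset ℕ), (l j * inner ℝ (X j) u) • X j = 0 := by
        intro j hj
        simp only [Finset.mem_insert, Finset.mem_singleton, not_or] at hj
        suffices inner ℝ (X j) u = 0 by rw [this, mul_zero, zero_smul]
        rw [hXu]
        rcases lt_or_ge j n with h | h
        · rw [if_neg (by omega), if_neg (by omega), if_neg (by omega)]; ring
        · rw [if_pos h, if_pos (by omega), if_pos (by omega), hξ]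
      convert hasSum_sum_of_ne_finset_zero (L := SummationFilter.unconditional ℕ) hz using 1
      rw [Finset.sum_pair (by omega), hXu, hXu, if_pos le_rfl, if_neg (by omega),
        if_neg (by omega), if_pos (by omega), if_pos le_rfl, if_neg (by omega)]
      have h3 : X (n + 1) = X n + ξ (n + 1) • e (n + 1) := Finset.sum_range_succ _ _
      have h4 := hlξ n
      have h5 := hlξ (n + 1)
      have h6 := hξ n
      have hne : ξ (n + 1) ≠ 0 := fun h => by rw [h, mul_zero] at h4; norm_num at h4
      have h7 : l (n + 1) * (b n * ξ n + a (n + 1) * ξ (n + 1)) * ξ (n + 1) = 1 := by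
        linear_combination l (n + 1) * ξ (n + 1) * h6 - h5
      -- Only j = n and j = n + 1 survive. After splitting `X (n + 1)` into `X n` and its last term,
      -- this is the vanishing of the coefficient of `X n`; `h7` normalizes what remains.
      have h8 : l n * (b n * ξ n) + l (n + 1) * (b n * ξ n + a (n + 1) * ξ (n + 1)) = 0 := by
        apply mul_right_cancel₀ hne
        linear_combination h4 + h7
      rw [h3]
      simp only [mul_zero, add_zero, smul_add, smul_smul]
      rw [h7, one_smul, ← add_assoc, ← add_smul, h8, zero_smul, zero_add]
    rw [hTu, (hSu u).unique h2, hu, inner_add_right, inner_add_right, real_inner_smul_right,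
      real_inner_smul_right, real_inner_smul_right, hx, hx, hx, hξ n, zero_smul, smul_zero,
      zero_add]
  obtain ⟨σ, hσ, hσ'⟩ := exists_isStieltjesSolution hb (hTc 0) (hTsymm 0) (hTpos 0 le_rfl) e
    (hT0 0) (hT1 0)
  obtain ⟨τ, hτ, hτ'⟩ := exists_isStieltjesSolution hb (hTc 1) (hTsymm 1) (hTpos 1 zero_le_one) e
    (hT0 1) (hT1 1)
  refine ⟨σ, τ, hσ, hτ, fun h => ?_⟩
  -- The two integrals of 1/x differ by ξ_0² = 1.
  rw [h, hτ', hTuv, hTuv, hx, hξ1] at hσ'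
  linarith

/-- A Jacobi matrix whose kernel solution `ξ` is square summable and whose string lengths `l` are
summable gives an indeterminate Stieltjes moment problem. -/
theorem isIndeterminateStieltjes_of_summable {a b ξ l : ℕ → ℝ} (hb : ∀ n, b n ≠ 0)
    (hξ0 : a 0 * ξ 0 + b 0 * ξ 1 = 0)
    (hξ : ∀ n, b n * ξ n + a (n + 1) * ξ (n + 1) + b (n + 1) * ξ (n + 2) = 0)
    (hξ1 : ξ 0 = 1) (hl : ∀ n, 0 ≤ l n) (hlξ : ∀ n, l n * b n * ξ n * ξ (n + 1) = -1)
    (hξs : Summable fun n => ξ n ^ 2) (hls : Summable l) : IsIndeterminateStieltjes a b := by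
  let e : HilbertBasis ℕ ℝ (lp (fun _ : ℕ => ℝ) 2) := ⟨LinearIsometryEquiv.refl ℝ _⟩
  have hmem : Memℓp ξ 2 := by
    rw [memℓp_gen_iff (by norm_num)]
    simpa using hξs
  refine isIndeterminateStieltjes_of_hilbertBasis hb hξ0 hξ hξ1 hl hlξ hξs hls e ⟨ξ, hmem⟩
    fun n => ?_
  rw [real_inner_comm, ← e.repr_apply_apply]; rfl

end Indeterminate

/-! ### Order of an entire function from bounds on its maximum modulus. -/

section EntireOrder

/-- Two-sided bounds `c r ^ ρ ≤ log M_f(r) ≤ C r ^ ρ log r` force the order of `f` to be `ρ`. -/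
lemma entireOrder_eq_of_bounds {f : ℂ → ℂ} {c C ρ : ℝ} (hc : 0 < c) (hC : 0 < C)
    (hlow : ∀ᶠ r in atTop, c * r ^ ρ ≤ Real.log (maxModulus f r))
    (hupp : ∀ᶠ r in atTop, Real.log (maxModulus f r) ≤ C * r ^ ρ * Real.log r) :
    entireOrder f = (ρ : EReal) := by
  have hlog : Tendsto Real.log atTop atTop := Real.tendsto_log_atTop
  have hloglog : Tendsto (fun r : ℝ => Real.log (Real.log r) / Real.log r) atTop (nhds 0) :=
    (Real.isLittleO_log_id_atTop.tendsto_div_nhds_zero).comp hlog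
  have hconst : ∀ k : ℝ, Tendsto (fun r : ℝ => k / Real.log r) atTop (nhds 0) := fun k =>
    tendsto_const_nhds.div_atTop hlog
  have ht : Tendsto (fun r : ℝ => Real.log (Real.log (maxModulus f r)) / Real.log r) atTop
      (nhds ρ) := by
    have h1 : Tendsto (fun r : ℝ => Real.log c / Real.log r + ρ) atTop (nhds ρ) := by
      simpa using (hconst (Real.log c)).add_const ρ
    have h2 : Tendsto (fun r : ℝ => Real.log C / Real.log r + ρ +
        Real.log (Real.log r) / Real.log r) atTop (nhds ρ) := by
      simpa using ((hconst (Real.log C)).add_const ρ).add hloglog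
    refine tendsto_of_tendsto_of_tendsto_of_le_of_le' h1 h2 ?_ ?_
    · filter_upwards [hlow, eventually_gt_atTop 1] with r hr hr1
      have hr0 : 0 < r := by linarith
      have hl := Real.log_pos hr1
      have := Real.log_le_log (mul_pos hc (Real.rpow_pos_of_pos hr0 ρ)) hr
      rw [Real.log_mul hc.ne' (Real.rpow_pos_of_pos hr0 ρ).ne', Real.log_rpow hr0] at this
      rw [le_div_iff₀ hl, add_mul, div_mul_cancel₀ _ hl.ne']
      exact this
    · filter_upwards [hlow, hupp, eventually_gt_atTop 1] with r hr hr' hr1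
      have hr0 : 0 < r := by linarith
      have hl := Real.log_pos hr1
      have hp := Real.rpow_pos_of_pos hr0 ρ
      have := Real.log_le_log ((mul_pos hc hp).trans_le hr) hr'
      rw [Real.log_mul (mul_pos hC hp).ne' hl.ne', Real.log_mul hC.ne' hp.ne',
        Real.log_rpow hr0] at this
      rw [div_le_iff₀ hl, add_mul, add_mul, div_mul_cancel₀ _ hl.ne', div_mul_cancel₀ _ hl.ne']
      exact this
  exact ((continuous_coe_real_ereal.tendsto ρ).comp ht).limsup_eq

lemma maxModulus_le {f : ℂ → ℂ} {r B : ℝ} (hr : 0 ≤ r) (h : ∀ z, ‖z‖ = r → ‖f z‖ ≤ B) :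
    maxModulus f r ≤ B := by
  refine csSup_le ((NormedSpace.sphere_nonempty.2 hr).image _) ?_
  rintro _ ⟨z, hz, rfl⟩
  exact h z (mem_sphere_zero_iff_norm.1 hz)

lemma norm_le_maxModulus {f : ℂ → ℂ} (hf : Continuous f) {r : ℝ} {z : ℂ} (hz : ‖z‖ = r) :
    ‖f z‖ ≤ maxModulus f r :=
  le_csSup ((isCompact_sphere (0 : ℂ) r).image hf.norm).bddAbove
    ⟨z, mem_sphere_zero_iff_norm.2 hz, rfl⟩

end EntireOrder

/-! ### Tails of convergent power series ∑ n^{-s}. -/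

section TailSums

/-- The integral comparison for x^{-s}, obtained from 1 + u ≤ e^u alone; the right-hand side
telescopes. -/
lemma rpow_neg_succ_le_sub {s : ℝ} (hs : 1 < s) {x : ℝ} (hx : 0 < x) :
    (x + 1) ^ (-s) ≤ (x ^ (1 - s) - (x + 1) ^ (1 - s)) / (s - 1) := by
  have hx1 : 0 < x + 1 := by linarith
  have h1 : x ≤ (x + 1) * Real.exp (-(x + 1)⁻¹) := by
    have := Real.add_one_le_exp (-(x + 1)⁻¹)
    calc x = (x + 1) * (-(x + 1)⁻¹ + 1) := by field_simp; ring
      _ ≤ _ := by gcongr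
  have h2 : (x + 1) ^ (1 - s) * (1 + (s - 1) * (x + 1)⁻¹) ≤ x ^ (1 - s) := by
    calc (x + 1) ^ (1 - s) * (1 + (s - 1) * (x + 1)⁻¹)
        ≤ (x + 1) ^ (1 - s) * Real.exp ((s - 1) * (x + 1)⁻¹) := by
          gcongr
          linarith [Real.add_one_le_exp ((s - 1) * (x + 1)⁻¹)]
      _ = ((x + 1) * Real.exp (-(x + 1)⁻¹)) ^ (1 - s) := by
          rw [Real.mul_rpow hx1.le (Real.exp_pos _).le, ← Real.exp_mul]
          ring_nf
      _ ≤ x ^ (1 - s) := Real.rpow_le_rpow_of_nonpos hx h1 (by linarith)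
  rw [le_div_iff₀ (by linarith)]
  have h3 : (x + 1) ^ (-s) = (x + 1) ^ (1 - s) * (x + 1)⁻¹ := by
    rw [← Real.rpow_neg_one, ← Real.rpow_add hx1]; ring_nf
  rw [h3]
  linarith

lemma sum_rpow_neg_tail_le {s : ℝ} (hs : 1 < s) {N : ℕ} (hN : 0 < N) (k : ℕ) :
    ∑ i ∈ Finset.range k, (((N + i : ℕ) : ℝ) + 1) ^ (-s) ≤ (N : ℝ) ^ (1 - s) / (s - 1) := by
  have hs' : 0 < s - 1 := by linarith
  have : ∑ i ∈ Finset.range k, (((N + i : ℕ) : ℝ) + 1) ^ (-s) ≤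
      ((N : ℝ) ^ (1 - s) - ((N + k : ℕ) : ℝ) ^ (1 - s)) / (s - 1) := by
    induction k with
    | zero => simp
    | succ k ih =>
      rw [Finset.sum_range_succ]
      have h := rpow_neg_succ_le_sub hs (x := ((N + k : ℕ) : ℝ)) (by positivity)
      rw [← add_assoc]
      push_cast at ih h ⊢
      calc _ ≤ _ := add_le_add ih h
        _ = _ := by ring
  refine this.trans ?_
  gcongr
  linarith [Real.rpow_nonneg (Nat.cast_nonneg (α := ℝ) (N + k)) (1 - s)]

end TailSums

/-! ### Growth of solutions of the discrete string recursion. -/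

section StringRecursion

/-- The solution of the recursion of a discrete string with masses `m` and lengths `l`: the first
component is the displacement, the second one the slope. -/
def stringSol {K : Type*} [Ring K] [Algebra ℝ K] (m l : ℕ → ℝ) (y w z : K) : ℕ → K × K
  | 0 => (y, w)
  | n + 1 => ((stringSol m l y w z n).1 + l n • ((stringSol m l y w z n).2 -
      m n • (z * (stringSol m l y w z n).1)),
      (stringSol m l y w z n).2 - m n • (z * (stringSol m l y w z n).1))

variable {m l : ℕ → ℝ}

lemma stringSol_ofReal (y w z : ℝ) (n : ℕ) :
    stringSol m l (y : ℂ) (w : ℂ) (z : ℂ) n =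
      (((stringSol m l y w z n).1 : ℂ), ((stringSol m l y w z n).2 : ℂ)) := by
  induction n with
  | zero => rfl
  | succ n ih => simp [stringSol, ih]

lemma differentiable_stringSol (y w : ℂ) (n : ℕ) :
    Differentiable ℂ (fun z => (stringSol m l y w z n).1) ∧
      Differentiable ℂ (fun z => (stringSol m l y w z n).2) := by
  induction n with
  | zero => exact ⟨differentiable_const _, differentiable_const _⟩
  | succ n ih =>
    obtain ⟨h1, h2⟩ := ih
    have h3 : Differentiable ℂ fun z => (stringSol m l y w z n).2 -
        m n • (z * (stringSol m l y w z n).1) := by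
      fun_prop
    exact ⟨by simp only [stringSol]; fun_prop, h3⟩

/-- A step is a product of two shears, one for the mass and one for the length. The weight `t` on
the slope is left free so that the two costs can be balanced later. -/
lemma norm_stringSol_succ_le (hm : ∀ n, 0 ≤ m n) (hl : ∀ n, 0 ≤ l n) {t r : ℝ} (ht : 0 < t)
    {y w z : ℂ} (hz : ‖z‖ ≤ r) (n : ℕ) :
    ‖(stringSol m l y w z (n + 1)).1‖ + t * ‖(stringSol m l y w z (n + 1)).2‖ ≤
      (1 + l n / t) * (1 + r * t * m n) *
        (‖(stringSol m l y w z n).1‖ + t * ‖(stringSol m l y w z n).2‖) := by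
  have hr : 0 ≤ r := (norm_nonneg z).trans hz
  simp only [stringSol]
  set Y := (stringSol m l y w z n).1
  set W := (stringSol m l y w z n).2
  set V := W - m n • (z * Y)
  have h1 : ‖V‖ ≤ ‖W‖ + m n * (r * ‖Y‖) := by
    refine (norm_sub_le _ _).trans ?_
    rw [norm_smul, norm_mul, Real.norm_of_nonneg (hm n)]
    have := hm n
    gcongr
  have h2 : ‖Y + l n • V‖ ≤ ‖Y‖ + l n * ‖V‖ := by
    refine (norm_add_le _ _).trans ?_
    rw [norm_smul, Real.norm_of_nonneg (hl n)]
  have hln := hl n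
  have hmn := hm n
  have hY := norm_nonneg Y
  have hW := norm_nonneg W
  calc ‖Y + l n • V‖ + t * ‖V‖ ≤ ‖Y‖ + (l n + t) * ‖V‖ := by linarith
    _ ≤ ‖Y‖ + (l n + t) * (‖W‖ + m n * (r * ‖Y‖)) := by gcongr
    _ = (1 + l n / t) * (1 + r * t * m n) * (‖Y‖ + t * ‖W‖) -
        (l n / t * ‖Y‖ + (1 + l n / t) * (r * t * m n) * (t * ‖W‖)) := by
      field_simp; ring
    _ ≤ _ := by
      rw [sub_le_self_iff]
      positivity

lemma norm_stringSol_le_pow {M : ℝ} (hm : ∀ n, 0 ≤ m n) (hl : ∀ n, 0 ≤ l n) (hmM : ∀ n, m n ≤ M)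
    (hlM : ∀ n, l n ≤ M) {r : ℝ} {y w z : ℂ} (hz : ‖z‖ ≤ r) (n : ℕ) :
    ‖(stringSol m l y w z n).1‖ + ‖(stringSol m l y w z n).2‖ ≤
      ((1 + M) * (1 + r * M)) ^ n * (‖y‖ + ‖w‖) := by
  have hr : 0 ≤ r := (norm_nonneg z).trans hz
  induction n with
  | zero => simp [stringSol]
  | succ n ih =>
    have h := norm_stringSol_succ_le hm hl one_pos hz (y := y) (w := w) n
    simp only [one_mul, div_one, mul_one] at h
    refine h.trans ?_
    have h1 := hmM n
    have h2 := hlM n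
    have h3 := hl n
    have h4 := hm n
    have h5 : 0 ≤ M := h4.trans h1
    have h6 : 0 ≤ (1 + M) * (1 + r * M) := by positivity
    rw [pow_succ', mul_assoc _ (_ ^ n)]
    gcongr

lemma norm_stringSol_add_le_exp (hm : ∀ n, 0 ≤ m n) (hl : ∀ n, 0 ≤ l n) {t r : ℝ} (ht : 0 < t)
    {y w z : ℂ} (hz : ‖z‖ ≤ r) (N k : ℕ) :
    ‖(stringSol m l y w z (N + k)).1‖ + t * ‖(stringSol m l y w z (N + k)).2‖ ≤
      Real.exp (∑ i ∈ Finset.range k, (l (N + i) / t + r * t * m (N + i))) *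
        (‖(stringSol m l y w z N).1‖ + t * ‖(stringSol m l y w z N).2‖) := by
  have hr : 0 ≤ r := (norm_nonneg z).trans hz
  induction k with
  | zero => simp
  | succ k ih =>
    rw [← add_assoc, Finset.sum_range_succ, add_comm (Finset.sum _ _), Real.exp_add, mul_assoc]
    refine (norm_stringSol_succ_le hm hl ht hz (N + k)).trans ?_
    have h3 := hl (N + k)
    have h4 := hm (N + k)
    have : (1 + l (N + k) / t) * (1 + r * t * m (N + k)) ≤
        Real.exp (l (N + k) / t + r * t * m (N + k)) := by
      rw [Real.exp_add]
      gcongr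
      · linarith [Real.add_one_le_exp (l (N + k) / t)]
      · linarith [Real.add_one_le_exp (r * t * m (N + k))]
    gcongr

/-- Growth of the solutions of a string recursion with power-like coefficients. -/
lemma exists_norm_stringSol_le {α β M : ℝ} (hα : 1 < α) (hβ : 1 < β) (hm : ∀ n, 0 ≤ m n)
    (hl : ∀ n, 0 ≤ l n) (hmM : ∀ n : ℕ, m n ≤ M * ((n : ℝ) + 1) ^ (-β))
    (hlM : ∀ n : ℕ, l n ≤ M * ((n : ℝ) + 1) ^ (-α)) :
    ∃ C, 0 ≤ C ∧ ∀ (y w z : ℂ) (r : ℝ), 1 ≤ r → ‖z‖ ≤ r → ∀ n,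
      ‖(stringSol m l y w z n).1‖ ≤
        (‖y‖ + ‖w‖) * Real.exp ((r ^ (1 / (α + β)) + 1) * (C + Real.log r)) := by
  have hM : 0 ≤ M := by simpa using (hm 0).trans (hmM 0)
  have hle : ∀ (n : ℕ) {s : ℝ}, 1 < s → M * ((n : ℝ) + 1) ^ (-s) ≤ M := fun n s hs =>
    mul_le_of_le_one_right hM (Real.rpow_le_one_of_one_le_of_nonpos (by simp) (by linarith))
  have hα' : 0 < α - 1 := by linarith
  have hβ' : 0 < β - 1 := by linarith
  have hq : 0 < α + β := by linarith
  have hlogM : 0 ≤ Real.log (1 + M) := Real.log_nonneg (by linarith)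
  refine ⟨M / (α - 1) + M / (β - 1) + 2 * Real.log (1 + M), by positivity, ?_⟩
  intro y w z r hr hz
  have hr0 : 0 < r := by linarith
  have hlogr : 0 ≤ Real.log r := Real.log_nonneg hr
  have hS0 : 0 ≤ ‖y‖ + ‖w‖ := by positivity
  -- The cut where r n^{-(α+β)} reaches 1: beyond it mass and length together are too weak for the
  -- crude bound on each step to be needed.
  set N := ⌈r ^ (1 / (α + β))⌉₊ with hNdef
  have hNr : r ^ (1 / (α + β)) ≤ N := Nat.le_ceil _
  have hrp : 0 < r ^ (1 / (α + β)) := Real.rpow_pos_of_pos hr0 _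
  have hN0 : 0 < N := Nat.ceil_pos.2 hrp
  have hN1 : (N : ℝ) ≤ r ^ (1 / (α + β)) + 1 := (Nat.ceil_lt_add_one hrp.le).le
  have hNpos : (0 : ℝ) < N := by exact_mod_cast hN0
  have hN1' : (1 : ℝ) ≤ N := by exact_mod_cast hN0
  have hrN : r ≤ (N : ℝ) ^ (α + β) := by
    calc r = (r ^ (1 / (α + β))) ^ (α + β) := by
          rw [← Real.rpow_mul hr0.le, one_div_mul_cancel hq.ne', Real.rpow_one]
      _ ≤ _ := by gcongr
  have hbase : (1 + M) * (1 + r * M) ≤ Real.exp (2 * Real.log (1 + M) + Real.log r) := by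
    rw [Real.exp_add, Real.exp_log hr0, two_mul, Real.exp_add, Real.exp_log (by linarith)]
    nlinarith
  have hbase0 : 0 ≤ (1 + M) * (1 + r * M) := by positivity
  have hfirst : ∀ n ≤ N, ‖(stringSol m l y w z n).1‖ + ‖(stringSol m l y w z n).2‖ ≤
      (‖y‖ + ‖w‖) * Real.exp (N * (2 * Real.log (1 + M) + Real.log r)) := by
    intro n hn
    refine (norm_stringSol_le_pow hm hl (fun k => (hmM k).trans (hle k hβ))
      (fun k => (hlM k).trans (hle k hα)) hz n).trans ?_
    rw [mul_comm]
    gcongr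
    calc ((1 + M) * (1 + r * M)) ^ n
        ≤ Real.exp (2 * Real.log (1 + M) + Real.log r) ^ n := by gcongr
      _ ≤ Real.exp (2 * Real.log (1 + M) + Real.log r) ^ N :=
          pow_le_pow_right₀ (Real.one_le_exp (by positivity)) hn
      _ = _ := by rw [← Real.exp_nat_mul]
  have hexp : ∀ x, 0 ≤ x → x ≤ M / (α - 1) + M / (β - 1) →
      (‖y‖ + ‖w‖) * Real.exp (N * (x + (2 * Real.log (1 + M) + Real.log r))) ≤
      (‖y‖ + ‖w‖) * Real.exp ((r ^ (1 / (α + β)) + 1) *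
        (M / (α - 1) + M / (β - 1) + 2 * Real.log (1 + M) + Real.log r)) := by
    intro x hx hx'
    refine mul_le_mul_of_nonneg_left (Real.exp_le_exp.2 (mul_le_mul hN1 ?_ ?_ ?_)) hS0
    · linarith
    · positivity
    · positivity
  intro n
  rcases le_total n N with hn | hn
  · refine le_trans ?_ (hexp 0 le_rfl (by positivity))
    rw [zero_add]
    exact (le_add_of_nonneg_right (norm_nonneg _)).trans (hfirst n hn)
  · obtain ⟨k, rfl⟩ := Nat.exists_eq_add_of_le hn
    -- The weight N^{-α} balances the tail: ∑ l/t and r t ∑ m are both O(N), because r ≤ N^{α+β}.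
    have ht : 0 < (N : ℝ) ^ (-α) := Real.rpow_pos_of_pos hNpos _
    have ht1 : (N : ℝ) ^ (-α) ≤ 1 := Real.rpow_le_one_of_one_le_of_nonpos hN1' (by linarith)
    have hsum : ∑ i ∈ Finset.range k, (l (N + i) / (N : ℝ) ^ (-α) +
        r * (N : ℝ) ^ (-α) * m (N + i)) ≤ N * (M / (α - 1) + M / (β - 1)) := by
      have h1 : ∑ i ∈ Finset.range k, l (N + i) ≤ M * ((N : ℝ) ^ (1 - α) / (α - 1)) := by
        refine (Finset.sum_le_sum fun i _ => hlM (N + i)).trans ?_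
        rw [← Finset.mul_sum]
        exact mul_le_mul_of_nonneg_left (sum_rpow_neg_tail_le hα hN0 k) hM
      have h2 : ∑ i ∈ Finset.range k, m (N + i) ≤ M * ((N : ℝ) ^ (1 - β) / (β - 1)) := by
        refine (Finset.sum_le_sum fun i _ => hmM (N + i)).trans ?_
        rw [← Finset.mul_sum]
        exact mul_le_mul_of_nonneg_left (sum_rpow_neg_tail_le hβ hN0 k) hM
      rw [Finset.sum_add_distrib, ← Finset.sum_div, ← Finset.mul_sum, mul_add]
      refine add_le_add ?_ ?_
      · rw [div_le_iff₀ ht]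
        refine h1.trans (le_of_eq ?_)
        rw [sub_eq_add_neg, Real.rpow_add hNpos, Real.rpow_one]
        ring
      · have h3 : 0 ≤ ∑ i ∈ Finset.range k, m (N + i) := Finset.sum_nonneg fun i _ => hm _
        calc r * (N : ℝ) ^ (-α) * ∑ i ∈ Finset.range k, m (N + i)
            ≤ (N : ℝ) ^ (α + β) * (N : ℝ) ^ (-α) * (M * ((N : ℝ) ^ (1 - β) / (β - 1))) := by
              gcongr
          _ = ((N : ℝ) ^ (α + β) * (N : ℝ) ^ (-α) * (N : ℝ) ^ (1 - β)) * (M / (β - 1)) := by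
              ring
          _ = N * (M / (β - 1)) := by
              rw [← Real.rpow_add hNpos, ← Real.rpow_add hNpos]
              rw [show α + β + -α + (1 - β) = 1 by ring, Real.rpow_one]
    refine le_trans ?_ (hexp (M / (α - 1) + M / (β - 1)) (by positivity) le_rfl)
    have h := norm_stringSol_add_le_exp hm hl ht hz (y := y) (w := w) N k
    refine (le_add_of_nonneg_right (mul_nonneg ht.le (norm_nonneg _))).trans (h.trans ?_)
    rw [mul_add (N : ℝ), Real.exp_add, mul_left_comm]
    refine mul_le_mul (Real.exp_le_exp.2 hsum) (le_trans ?_ (hfirst N le_rfl)) (by positivity)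
      (by positivity)
    gcongr
    exact mul_le_of_le_one_left (norm_nonneg _) ht1

lemma stringSol_neg_nonneg (hm : ∀ n, 0 ≤ m n) (hl : ∀ n, 0 ≤ l n) {y w r : ℝ} (hy : 0 ≤ y)
    (hw : 0 ≤ w) (hr : 0 ≤ r) (n : ℕ) :
    0 ≤ (stringSol m l y w (-r) n).1 ∧ 0 ≤ (stringSol m l y w (-r) n).2 := by
  induction n with
  | zero => exact ⟨hy, hw⟩
  | succ n ih =>
    obtain ⟨h1, h2⟩ := ih
    have h3 := hm n
    have h4 := hl n
    have h5 : 0 ≤ (stringSol m l y w (-r) n).2 -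
        m n • (-r * (stringSol m l y w (-r) n).1) := by
      rw [smul_eq_mul, neg_mul, mul_neg, sub_neg_eq_add]; positivity
    exact ⟨add_nonneg h1 (smul_nonneg h4 h5), h5⟩

lemma stringSol_neg_succ (y w r : ℝ) (n : ℕ) :
    (1 + r * (l n * m n)) * (stringSol m l y w (-r) n).1 + l n * (stringSol m l y w (-r) n).2 =
      (stringSol m l y w (-r) (n + 1)).1 := by
  simp only [stringSol, smul_eq_mul]
  ring

/-- At -r nothing cancels, and the displacement is multiplied by at least 1 + r l_n m_n, which is at
least 2 in the stated range. Counting from index 1 also covers y = 0, where the string is set in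
motion by its slope. -/
lemma two_pow_mul_le_stringSol {q κ : ℝ} (hq : 0 < q) (hm : ∀ n, 0 ≤ m n) (hl : ∀ n, 0 ≤ l n)
    (hml : ∀ n : ℕ, κ * ((n : ℝ) + 1) ^ (-q) ≤ l n * m n)
    {y w r : ℝ} (hy : 0 ≤ y) (hw : 0 ≤ w) (hr : 0 ≤ r) (n : ℕ)
    (hn : ((n : ℝ) + 1) ^ q ≤ κ * r) :
    2 ^ n * (y + l 0 * w) ≤ (stringSol m l y w (-r) (n + 1)).1 := by
  have hnn := stringSol_neg_nonneg hm hl hy hw hr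
  induction n with
  | zero =>
    refine le_trans ?_ (stringSol_neg_succ y w r 0).le
    have h1 := hl 0
    have h2 := hm 0
    simp only [stringSol, pow_zero, one_mul]
    gcongr
    exact le_mul_of_one_le_left hy (le_add_of_nonneg_right (by positivity))
  | succ n ih =>
    have hle : ((n : ℝ) + 1) ^ q ≤ κ * r := by
      refine le_trans ?_ hn
      push_cast
      gcongr
      linarith
    refine le_trans ?_ (stringSol_neg_succ y w r (n + 1)).le
    have h1 := hml (n + 1)
    have hpos : (0 : ℝ) < ((n + 1 : ℕ) : ℝ) + 1 := by positivity
    have h2 : 1 ≤ r * (l (n + 1) * m (n + 1)) := by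
      calc (1 : ℝ) = (((n + 1 : ℕ) : ℝ) + 1) ^ q * (((n + 1 : ℕ) : ℝ) + 1) ^ (-q) := by
            rw [← Real.rpow_add hpos, add_neg_cancel, Real.rpow_zero]
        _ ≤ κ * r * (((n + 1 : ℕ) : ℝ) + 1) ^ (-q) := by gcongr
        _ = r * (κ * (((n + 1 : ℕ) : ℝ) + 1) ^ (-q)) := by ring
        _ ≤ _ := by gcongr
    have h3 := (hnn (n + 1)).1
    have h4 := mul_nonneg (hl (n + 1)) (hnn (n + 1)).2
    have h5 := mul_le_mul_of_nonneg_right h2 h3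
    rw [pow_succ]
    linarith [ih hle]

end StringRecursion

/-! ### Entire functions given by series of string displacements. -/

section StringSeries

/-- Since log 2 > 6/10, the surplus of 2^n over e^{n/2} is at least e^{n/10}, which absorbs any
power of n. -/
lemma eventually_exp_half_add_one_le {κ s : ℝ} (hκ : 0 < κ) :
    ∀ᶠ n : ℕ in atTop, Real.exp (n / 2) + 1 ≤ κ * (((n + 1 : ℕ) : ℝ) + 1) ^ (-s) * 2 ^ n := by
  have ht := (tendsto_rpow_mul_exp_neg_mul_atTop_nhds_zero s (1 / 10) (by norm_num)).comp
    (tendsto_atTop_add_const_right atTop (2 : ℝ) tendsto_natCast_atTop_atTop)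
  have hδ : 0 < κ * Real.exp (-(1 / 5)) / 2 := by positivity
  filter_upwards [ht.eventually_le_const hδ] with n hn
  have hx : (((n + 1 : ℕ) : ℝ) + 1) = (n : ℝ) + 2 := by push_cast; ring
  rw [hx]
  have hx0 : (0 : ℝ) < (n : ℝ) + 2 := by positivity
  simp only [Function.comp] at hn
  have hp : 0 < ((n : ℝ) + 2) ^ s := Real.rpow_pos_of_pos hx0 s
  have h1 : 2 * Real.exp (-(1 / 10) * n) ≤ κ * ((n : ℝ) + 2) ^ (-s) := by
    rw [Real.rpow_neg hx0.le, ← div_eq_mul_inv, le_div_iff₀ hp]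
    have : Real.exp (-(1 / 10) * ((n : ℝ) + 2)) =
        Real.exp (-(1 / 10) * n) * Real.exp (-(1 / 5)) := by
      rw [← Real.exp_add]; ring_nf
    rw [this] at hn
    have h5 := Real.exp_pos (-(1 / 5) : ℝ)
    refine le_of_mul_le_mul_right ?_ h5
    linarith
  have h2 : Real.exp (6 / 10 * n) ≤ 2 ^ n := by
    rw [← Real.exp_log (show (0 : ℝ) < 2 ^ n by positivity), Real.log_pow, mul_comm]
    gcongr
    linarith [Real.log_two_gt_d9]
  calc Real.exp (n / 2) + 1 ≤ Real.exp (n / 2) + Real.exp (n / 2) := by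
        gcongr
        exact Real.one_le_exp (by positivity)
    _ = 2 * Real.exp (-(1 / 10) * n) * Real.exp (6 / 10 * n) := by
        rw [mul_assoc, ← Real.exp_add]; ring_nf
    _ ≤ _ := by gcongr

/-- A series of displacements of a string with power-like coefficients is a non-constant entire
function of order `1 / (α + β)`. -/
theorem entireOrder_string_series {m l w : ℕ → ℝ} {α β M κ s y v : ℝ} (hα : 1 < α) (hβ : 1 < β)
    (hm : ∀ n, 0 ≤ m n) (hl : ∀ n, 0 ≤ l n) (hmM : ∀ n : ℕ, m n ≤ M * ((n : ℝ) + 1) ^ (-β))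
    (hlM : ∀ n : ℕ, l n ≤ M * ((n : ℝ) + 1) ^ (-α)) (hκ : 0 < κ)
    (hml : ∀ n : ℕ, κ * ((n : ℝ) + 1) ^ (-(α + β)) ≤ l n * m n)
    (hw : ∀ n, 0 ≤ w n) (hws : Summable w)
    (hwκ : ∀ n : ℕ, κ * (((n + 1 : ℕ) : ℝ) + 1) ^ (-s) ≤ w (n + 1)) (hy : 0 ≤ y) (hv : 0 ≤ v)
    (hyv : 0 < y + l 0 * v) {c σ : ℂ} (hc : ‖c‖ ≤ 1) (hσ : ‖σ‖ = 1) {f : ℂ → ℂ}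
    (hf : ∀ z, f z = c + σ * (z * ∑' k, (w k : ℂ) * (stringSol m l (y : ℂ) (v : ℂ) z k).1)) :
    Differentiable ℂ f ∧ (¬ ∃ c : ℂ, ∀ z, f z = c) ∧
      entireOrder f = ((1 / (α + β) : ℝ) : EReal) := by
  have hq : 0 < α + β := by linarith
  obtain ⟨C, hC, hbound⟩ := exists_norm_stringSol_le hα hβ hm hl hmM hlM
  set A : ℝ := ‖(y : ℂ)‖ + ‖(v : ℂ)‖ with hA
  set B : ℝ → ℝ := fun r => A * Real.exp ((r ^ (1 / (α + β)) + 1) * (C + Real.log r)) with hB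
  have hA0 : 0 ≤ A := by positivity
  have hterm : ∀ r, 1 ≤ r → ∀ z : ℂ, ‖z‖ ≤ r → ∀ k,
      ‖(w k : ℂ) * (stringSol m l (y : ℂ) (v : ℂ) z k).1‖ ≤ w k * B r := fun r hr z hz k => by
    rw [norm_mul, Complex.norm_of_nonneg (hw k)]
    exact mul_le_mul_of_nonneg_left (hbound y v z r hr hz k) (hw k)
  have hsB : ∀ r, Summable fun k => w k * B r := fun r => hws.mul_right _
  have hdiff : Differentiable ℂ f := by
    have h1 : Differentiable ℂ
        fun z => ∑' k, (w k : ℂ) * (stringSol m l (y : ℂ) (v : ℂ) z k).1 := by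
      intro z
      have hr : 1 ≤ ‖z‖ + 1 := by linarith [norm_nonneg z]
      refine (Complex.differentiableOn_tsum_of_summable_norm (hsB (‖z‖ + 1))
        (fun k => (((differentiable_stringSol (y : ℂ) (v : ℂ) k).1).const_mul
          (w k : ℂ)).differentiableOn)
        Metric.isOpen_ball (U := Metric.ball 0 (‖z‖ + 1)) ?_).differentiableAt
        (Metric.isOpen_ball.mem_nhds (by simp))
      intro k u hu
      exact hterm _ hr u (mem_ball_zero_iff.1 hu).le k
    have : f = fun z => c + σ * (z * ∑' k, (w k : ℂ) * (stringSol m l (y : ℂ) (v : ℂ) z k).1) :=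
      funext hf
    rw [this]
    fun_prop
  -- All terms of the series at -r are nonnegative, so a single one bounds it from below; the
  -- constant `c` costs at most 1.
  have hlower : ∀ r, 1 ≤ r → ∀ n, r * (w n * (stringSol m l y v (-r) n).1) - 1 ≤ ‖f (-r : ℝ)‖ := by
    intro r hr n
    have hnn := fun k => (stringSol_neg_nonneg hm hl hy hv (by linarith : 0 ≤ r) k).1
    have hreal : ∀ k, (w k : ℂ) * (stringSol m l (y : ℂ) (v : ℂ) (-r : ℝ) k).1 =
        ((w k * (stringSol m l y v (-r) k).1 : ℝ) : ℂ) := fun k => by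
      rw [stringSol_ofReal]; push_cast; rfl
    have hsum : Summable fun k => w k * (stringSol m l y v (-r) k).1 := by
      refine Summable.of_norm_bounded (hsB r) fun k => ?_
      have := hterm r hr (-r : ℝ) (by simp [abs_of_nonneg (by linarith : 0 ≤ r)]) k
      rwa [hreal, Complex.norm_real] at this
    have hle := hsum.le_tsum n fun k _ => mul_nonneg (hw k) (hnn k)
    have hS0 : 0 ≤ ∑' k, w k * (stringSol m l y v (-r) k).1 :=
      tsum_nonneg fun k => mul_nonneg (hw k) (hnn k)
    rw [hf]
    simp only [hreal]
    rw [← Complex.ofReal_tsum]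
    have h2 := norm_sub_norm_le (σ * (((-r : ℝ) : ℂ) *
      ((∑' k, w k * (stringSol m l y v (-r) k).1 : ℝ) : ℂ))) (-c)
    rw [sub_neg_eq_add, add_comm _ c, norm_mul, norm_mul, hσ, one_mul, norm_neg,
      Complex.norm_real, Complex.norm_real, norm_neg, Real.norm_of_nonneg hS0,
      Real.norm_of_nonneg (by linarith : 0 ≤ r)] at h2
    refine le_trans ?_ h2
    gcongr
  have hexp : ∀ᶠ r : ℝ in atTop,
      κ ^ (1 / (α + β)) / 4 * r ^ (1 / (α + β)) ≤ Real.log ‖f (-r : ℝ)‖ := by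
    have hT : Tendsto (fun r : ℝ => (κ * r) ^ (1 / (α + β))) atTop atTop :=
      (tendsto_rpow_atTop (one_div_pos.2 hq)).comp (tendsto_id.const_mul_atTop hκ)
    -- This floor is the last index at which doubling is guaranteed.
    have hT' : Tendsto (fun r : ℝ => ⌊(κ * r) ^ (1 / (α + β)) - 1⌋₊) atTop atTop :=
      tendsto_nat_floor_atTop.comp (tendsto_atTop_add_const_right _ (-1) hT)
    filter_upwards [eventually_ge_atTop 1, hT.eventually_ge_atTop 4,
      hT'.eventually (eventually_exp_half_add_one_le (s := s) (mul_pos hκ hyv))] with r hr hr4 hn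
    set x := (κ * r) ^ (1 / (α + β)) with hx
    set n := ⌊x - 1⌋₊ with hndef
    have hr0 : 0 < r := by linarith
    have hκr : 0 < κ * r := mul_pos hκ hr0
    have hn1 : (n : ℝ) ≤ x - 1 := Nat.floor_le (by linarith)
    have hn2 : x - 1 < n + 1 := Nat.lt_floor_add_one _
    have hnq : ((n : ℝ) + 1) ^ (α + β) ≤ κ * r := by
      calc ((n : ℝ) + 1) ^ (α + β) ≤ x ^ (α + β) := by gcongr; linarith
        _ = κ * r := by rw [hx, ← Real.rpow_mul hκr.le, one_div_mul_cancel hq.ne', Real.rpow_one]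
    have h1 := two_pow_mul_le_stringSol hq hm hl hml hy hv hr0.le n hnq
    have h2 : Real.exp (n / 2) ≤ ‖f (-r : ℝ)‖ := by
      refine le_trans ?_ (hlower r hr (n + 1))
      rw [le_sub_iff_add_le]
      refine hn.trans ?_
      have h3 : 0 ≤ w (n + 1) * (stringSol m l y v (-r) (n + 1)).1 :=
        mul_nonneg (hw _) (stringSol_neg_nonneg hm hl hy hv hr0.le _).1
      calc κ * (y + l 0 * v) * (((n + 1 : ℕ) : ℝ) + 1) ^ (-s) * 2 ^ n
          = κ * (((n + 1 : ℕ) : ℝ) + 1) ^ (-s) * (2 ^ n * (y + l 0 * v)) := by ring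
        _ ≤ w (n + 1) * (stringSol m l y v (-r) (n + 1)).1 :=
            mul_le_mul (hwκ n) h1 (by positivity) (hw _)
        _ ≤ _ := le_mul_of_one_le_left h3 hr
    have h3 := Real.log_le_log (Real.exp_pos _) h2
    rw [Real.log_exp] at h3
    have h4 : κ ^ (1 / (α + β)) / 4 * r ^ (1 / (α + β)) = x / 4 := by
      rw [hx, Real.mul_rpow hκ.le hr0.le]; ring
    rw [h4]
    linarith
  have hκ4 : 0 < κ ^ (1 / (α + β)) / 4 := by positivity
  refine ⟨hdiff, ?_, ?_⟩
  · rintro ⟨a, ha⟩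
    have hT : Tendsto (fun r : ℝ => κ ^ (1 / (α + β)) / 4 * r ^ (1 / (α + β))) atTop atTop :=
      (tendsto_rpow_atTop (one_div_pos.2 hq)).const_mul_atTop hκ4
    obtain ⟨r, hr1, hr2⟩ := (hexp.and (hT.eventually_gt_atTop (Real.log ‖a‖))).exists
    rw [ha] at hr1
    linarith
  · set S := ∑' k, w k with hS
    have hS0 : 0 ≤ S := tsum_nonneg hw
    have hlogS : 0 ≤ Real.log (1 + S * A) := Real.log_nonneg (by nlinarith)
    refine entireOrder_eq_of_bounds hκ4
      (C := Real.log (1 + S * A) + 1 + 2 * (C + 1)) (by positivity) ?_ ?_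
    · filter_upwards [hexp, eventually_ge_atTop 1,
        hexp.and (eventually_gt_atTop 0)] with r hr hr1 hr0
      refine hr.trans (Real.log_le_log ?_ (norm_le_maxModulus hdiff.continuous ?_))
      · by_contra h
        have : ‖f (-r : ℝ)‖ = 0 := le_antisymm (not_lt.1 h) (norm_nonneg _)
        rw [this, Real.log_zero] at hr
        have := mul_pos hκ4 (Real.rpow_pos_of_pos hr0.2 (1 / (α + β)))
        linarith
      · simp [abs_of_nonneg (by linarith : 0 ≤ r)]
    · filter_upwards [eventually_ge_atTop (Real.exp 1), hexp] with r hre hrl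
      have hr1 : 1 ≤ r := le_trans (Real.one_le_exp zero_le_one) hre
      have hr0 : 0 < r := by linarith
      have hlog1 : 1 ≤ Real.log r := (Real.le_log_iff_exp_le hr0).2 hre
      set x := r ^ (1 / (α + β)) with hx
      have hx1 : 1 ≤ x := Real.one_le_rpow hr1 (by positivity)
      have hmax : maxModulus f r ≤ 1 + r * (S * B r) := by
        refine maxModulus_le hr0.le fun z hz => ?_
        rw [hf]
        refine (norm_add_le _ _).trans (add_le_add hc ?_)
        rw [norm_mul, norm_mul, hσ, one_mul, hz]
        gcongr
        rw [hS, ← tsum_mul_right]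
        exact tsum_of_norm_bounded (hsB r).hasSum (hterm r hr1 z hz.le)
      have hpos : 0 < maxModulus f r := by
        have h1 := norm_le_maxModulus hdiff.continuous
          (show ‖((-r : ℝ) : ℂ)‖ = r by simp [abs_of_pos hr0])
        refine lt_of_lt_of_le ?_ h1
        by_contra h
        have : ‖f (-r : ℝ)‖ = 0 := le_antisymm (not_lt.1 h) (norm_nonneg _)
        rw [this, Real.log_zero] at hrl
        have := mul_pos hκ4 (Real.rpow_pos_of_pos hr0 (1 / (α + β)))
        linarith
      set D := (x + 1) * (C + Real.log r) with hD
      have hD0 : 0 ≤ D := by positivity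
      have h2 : maxModulus f r ≤ (1 + S * A) * (r * Real.exp D) := by
        refine hmax.trans ?_
        have h3 : 1 ≤ r * Real.exp D := by
          have := Real.one_le_exp hD0
          nlinarith
        calc 1 + r * (S * B r) = 1 + S * A * (r * Real.exp D) := by simp only [hB]; ring
          _ ≤ r * Real.exp D + S * A * (r * Real.exp D) := by gcongr
          _ = _ := by ring
      have h3 := Real.log_le_log hpos h2
      rw [Real.log_mul (by positivity) (by positivity), Real.log_mul hr0.ne' (Real.exp_pos _).ne',
        Real.log_exp] at h3
      refine h3.trans ?_
      have hxl : 1 ≤ x * Real.log r := one_le_mul_of_one_le_of_one_le hx1 hlog1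
      have h4 : D ≤ 2 * (C + 1) * (x * Real.log r) := by
        calc D ≤ (2 * x) * ((C + 1) * Real.log r) := by
              rw [hD]
              gcongr
              · linarith
              · nlinarith
          _ = _ := by ring
      have h5 : Real.log (1 + S * A) ≤ Real.log (1 + S * A) * (x * Real.log r) :=
        le_mul_of_one_le_right hlogS hxl
      have h6 : Real.log r ≤ x * Real.log r := le_mul_of_one_le_left (by linarith) hx1
      rw [mul_assoc, add_mul, add_mul, one_mul]
      linarith

end StringSeries

/-! ### Birth and death processes as strings. -/

section BirthDeath

/-- The potential coefficients `π_n = λ_0 ⋯ λ_{n-1} / (μ_1 ⋯ μ_n)`. -/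
noncomputable def potential (lam mu : ℕ → ℝ) (n : ℕ) : ℝ :=
  ∏ k ∈ Finset.range n, lam k / mu (k + 1)

/-- The lengths `1 / (λ_n π_n)` of the associated string. -/
noncomputable def stringLength (lam mu : ℕ → ℝ) (n : ℕ) : ℝ := (lam n * potential lam mu n)⁻¹

/-- The values `P_n(0) = (-1)^n √π_n`. -/
noncomputable def signedRoot (lam mu : ℕ → ℝ) (n : ℕ) : ℝ :=
  (-1) ^ n * Real.sqrt (potential lam mu n)

lemma potential_succ {lam mu : ℕ → ℝ} (hmu : ∀ n, 0 < mu (n + 1)) (n : ℕ) :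
    mu (n + 1) * potential lam mu (n + 1) = lam n * potential lam mu n := by
  rw [potential, Finset.prod_range_succ, ← potential]
  have := (hmu n).ne'
  field_simp

variable {lam mu : ℕ → ℝ} (hlam : ∀ n, 0 < lam n) (hmu : ∀ n, 0 < mu (n + 1))

section
include hlam hmu

lemma potential_pos (n : ℕ) : 0 < potential lam mu n :=
  Finset.prod_pos fun k _ => div_pos (hlam k) (hmu k)

lemma stringLength_pos (n : ℕ) : 0 < stringLength lam mu n :=
  inv_pos.2 (mul_pos (hlam n) (potential_pos hlam hmu n))

lemma birthDeathB_pos (n : ℕ) : 0 < birthDeathB lam mu n :=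
  Real.sqrt_pos.2 (mul_pos (hlam n) (hmu n))

lemma signedRoot_sq (n : ℕ) : signedRoot lam mu n ^ 2 = potential lam mu n := by
  rw [signedRoot, mul_pow, ← pow_mul, mul_comm n 2, pow_mul, neg_one_sq, one_pow, one_mul,
    Real.sq_sqrt (potential_pos hlam hmu n).le]

lemma birthDeathB_mul_signedRoot_succ (n : ℕ) :
    birthDeathB lam mu n * signedRoot lam mu (n + 1) = -(lam n * signedRoot lam mu n) := by
  have h : Real.sqrt (lam n * mu (n + 1)) * Real.sqrt (potential lam mu (n + 1)) =
      lam n * Real.sqrt (potential lam mu n) := by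
    rw [← Real.sqrt_mul (mul_pos (hlam n) (hmu n)).le, mul_assoc, potential_succ hmu,
      ← mul_assoc, Real.sqrt_mul (mul_self_nonneg _), Real.sqrt_mul_self (hlam n).le]
  rw [birthDeathB, signedRoot, signedRoot, pow_succ]
  linear_combination -(-1) ^ n * h

lemma birthDeathB_mul_signedRoot (n : ℕ) :
    birthDeathB lam mu n * signedRoot lam mu n = -(mu (n + 1) * signedRoot lam mu (n + 1)) := by
  have h : Real.sqrt (lam n * mu (n + 1)) * Real.sqrt (potential lam mu n) =
      mu (n + 1) * Real.sqrt (potential lam mu (n + 1)) := by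
    rw [← Real.sqrt_mul (mul_pos (hlam n) (hmu n)).le, mul_comm (lam n), mul_assoc,
      ← potential_succ hmu, ← mul_assoc, Real.sqrt_mul (mul_self_nonneg _),
      Real.sqrt_mul_self (hmu n).le]
  rw [birthDeathB, signedRoot, signedRoot, pow_succ]
  linear_combination (-1) ^ n * h

/-- A birth and death process with `∑ π_n < ∞` and `∑ 1 / (λ_n π_n) < ∞` gives an indeterminate
Stieltjes moment problem. -/
theorem isIndeterminateStieltjes_birthDeath (hmu0 : mu 0 = 0)
    (hπ : Summable (potential lam mu)) (hL : Summable (stringLength lam mu)) :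
    IsIndeterminateStieltjes (birthDeathA lam mu) (birthDeathB lam mu) := by
  refine isIndeterminateStieltjes_of_summable (ξ := signedRoot lam mu) (l := stringLength lam mu)
    (fun n => (birthDeathB_pos hlam hmu n).ne') ?_ (fun n => ?_) ?_
    (fun n => (stringLength_pos hlam hmu n).le) (fun n => ?_) ?_ hL
  · rw [birthDeathB_mul_signedRoot_succ hlam hmu, birthDeathA, hmu0]; ring
  · rw [birthDeathB_mul_signedRoot_succ hlam hmu, birthDeathB_mul_signedRoot hlam hmu,
      birthDeathA]
    ring
  · simp [signedRoot, potential]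
  · have h1 := birthDeathB_mul_signedRoot_succ hlam hmu n
    have h2 := signedRoot_sq hlam hmu n
    have h3 : stringLength lam mu n * (lam n * potential lam mu n) = 1 :=
      inv_mul_cancel₀ (mul_pos (hlam n) (potential_pos hlam hmu n)).ne'
    linear_combination stringLength lam mu n * signedRoot lam mu n * h1 -
      stringLength lam mu n * lam n * h2 - h3
  · simpa only [signedRoot_sq hlam hmu] using hπ

/-- Eliminate the slopes: 1/(l_n π_{n+1}) = μ_{n+1} and 1/(l_{n+1} π_{n+1}) = λ_{n+1}, so the string
equation becomes the birth and death difference equation. -/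
lemma stringSol_three_term (y w z : ℂ) (n : ℕ) :
    (lam (n + 1) : ℂ) *
      ((stringSol (potential lam mu) (stringLength lam mu) y w z (n + 2)).1 -
        (stringSol (potential lam mu) (stringLength lam mu) y w z (n + 1)).1) =
    (mu (n + 1) : ℂ) *
      ((stringSol (potential lam mu) (stringLength lam mu) y w z (n + 1)).1 -
        (stringSol (potential lam mu) (stringLength lam mu) y w z n).1) -
    z * (stringSol (potential lam mu) (stringLength lam mu) y w z (n + 1)).1 := by
  have e1 : (stringSol (potential lam mu) (stringLength lam mu) y w z (n + 2)).1 =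
      (stringSol (potential lam mu) (stringLength lam mu) y w z (n + 1)).1 +
      stringLength lam mu (n + 1) •
        ((stringSol (potential lam mu) (stringLength lam mu) y w z (n + 1)).2 -
      potential lam mu (n + 1) •
        (z * (stringSol (potential lam mu) (stringLength lam mu) y w z (n + 1)).1)) := rfl
  have e2 : (stringSol (potential lam mu) (stringLength lam mu) y w z (n + 1)).1 =
      (stringSol (potential lam mu) (stringLength lam mu) y w z n).1 +
      stringLength lam mu n •
        (stringSol (potential lam mu) (stringLength lam mu) y w z (n + 1)).2 := rfl
  have h1 : stringLength lam mu (n + 1) * (lam (n + 1) * potential lam mu (n + 1)) = 1 :=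
    inv_mul_cancel₀ (mul_pos (hlam _) (potential_pos hlam hmu _)).ne'
  have h2 : stringLength lam mu n * (mu (n + 1) * potential lam mu (n + 1)) = 1 := by
    rw [potential_succ hmu]
    exact inv_mul_cancel₀ (mul_pos (hlam _) (potential_pos hlam hmu _)).ne'
  have h3 : lam (n + 1) * stringLength lam mu (n + 1) = mu (n + 1) * stringLength lam mu n := by
    apply mul_right_cancel₀ (potential_pos hlam hmu (n + 1)).ne'
    linear_combination h1 - h2
  have h1' := congrArg (fun x : ℝ => (x : ℂ)) h1
  have h3' := congrArg (fun x : ℝ => (x : ℂ)) h3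
  simp only [Complex.ofReal_mul, Complex.ofReal_one] at h1' h3'
  simp only [Complex.real_smul] at e1 e2
  set Y := (stringSol (potential lam mu) (stringLength lam mu) y w z (n + 1)).1
  set W := (stringSol (potential lam mu) (stringLength lam mu) y w z (n + 1)).2
  linear_combination (lam (n + 1) : ℂ) * e1 - (mu (n + 1) : ℂ) * e2 + W * h3' - z * Y * h1'

/-- Conjugation by (-1)^n √π_n turns the Jacobi recurrence into the birth and death one. The factor
`k` is 1 for the first kind and -1 for the second. -/
lemma eq_signedRoot_mul_stringSol {k y w z : ℂ} {r : ℕ → ℂ} (h0 : r 0 = k * y)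
    (h1 : r 1 = k * (signedRoot lam mu 1 *
      (stringSol (potential lam mu) (stringLength lam mu) y w z 1).1))
    (hr : ∀ n, (birthDeathB lam mu (n + 1) : ℂ) * r (n + 2) =
      (z - birthDeathA lam mu (n + 1)) * r (n + 1) - birthDeathB lam mu n * r n) (n : ℕ) :
    r n = k * (signedRoot lam mu n *
      (stringSol (potential lam mu) (stringLength lam mu) y w z n).1) := by
  induction n using Nat.twoStepInduction with
  | zero => simp [h0, signedRoot, potential, stringSol]
  | one => exact h1
  | more n ih1 ih2 =>
    have hb : (birthDeathB lam mu (n + 1) : ℂ) ≠ 0 :=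
      Complex.ofReal_ne_zero.2 (birthDeathB_pos hlam hmu (n + 1)).ne'
    apply mul_left_cancel₀ hb
    rw [hr, ih1, ih2]
    have e1 := congrArg (fun x : ℝ => (x : ℂ)) (birthDeathB_mul_signedRoot_succ hlam hmu (n + 1))
    have e2 := congrArg (fun x : ℝ => (x : ℂ)) (birthDeathB_mul_signedRoot hlam hmu n)
    have e3 := stringSol_three_term hlam hmu y w z n
    simp only [Complex.ofReal_mul, Complex.ofReal_neg] at e1 e2
    rw [birthDeathA, Complex.ofReal_add]
    linear_combination -k * (stringSol (potential lam mu) (stringLength lam mu) y w z n).1 * e2 -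
      k * (stringSol (potential lam mu) (stringLength lam mu) y w z (n + 2)).1 * e1 +
      k * signedRoot lam mu (n + 1) * e3

lemma signedRoot_one_mul (z : ℝ) : signedRoot lam mu 1 * (stringLength lam mu 0 * z) =
    -(birthDeathB lam mu 0)⁻¹ * z := by
  have h := birthDeathB_mul_signedRoot_succ hlam hmu 0
  have hb := (birthDeathB_pos hlam hmu 0).ne'
  have hl := (hlam 0).ne'
  have h0 : signedRoot lam mu 0 = 1 := by simp [signedRoot, potential]
  rw [h0] at h
  have : stringLength lam mu 0 = (lam 0)⁻¹ := by simp [stringLength, potential]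
  rw [this]
  field_simp
  linear_combination z * h

lemma aeval_orthoP_eq (hmu0 : mu 0 = 0) (z : ℂ) (n : ℕ) :
    aeval z (orthoP (birthDeathA lam mu) (birthDeathB lam mu) n) =
      signedRoot lam mu n * (stringSol (potential lam mu) (stringLength lam mu) 1 0 z n).1 := by
  have hb : ∀ n, (birthDeathB lam mu n : ℂ) ≠ 0 := fun n =>
    Complex.ofReal_ne_zero.2 (birthDeathB_pos hlam hmu n).ne'
  have key := eq_signedRoot_mul_stringSol hlam hmu (k := 1) (y := 1) (w := 0) (z := z)
    (r := fun n => aeval z (orthoP (birthDeathA lam mu) (birthDeathB lam mu) n)) ?_ ?_ ?_ n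
  · rw [key, one_mul]
  · simp [orthoP]
  · have h := congrArg (fun x : ℝ => (x : ℂ)) (signedRoot_one_mul hlam hmu 1)
    have h2 := congrArg (fun x : ℝ => (x : ℂ)) (birthDeathB_mul_signedRoot_succ hlam hmu 0)
    have h0 : signedRoot lam mu 0 = 1 := by simp [signedRoot, potential]
    simp only [Complex.ofReal_mul, Complex.ofReal_neg, Complex.ofReal_inv, Complex.ofReal_one,
      h0, zero_add] at h h2
    have hπ : potential lam mu 0 = 1 := by simp [potential]
    simp only [orthoP, stringSol, hπ, map_mul, map_sub, aeval_X, aeval_C, Complex.coe_algebraMap,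
      Complex.real_smul, birthDeathA, hmu0, Complex.ofReal_inv, Complex.ofReal_one, add_zero]
    apply mul_left_cancel₀ (hb 0)
    rw [mul_inv_cancel_left₀ (hb 0)]
    have h3 := mul_inv_cancel₀ (hb 0)
    linear_combination birthDeathB lam mu 0 * z * h - h2 - z * h3
  · intro n
    simp only [orthoP, map_mul, map_sub, aeval_X, aeval_C, Complex.coe_algebraMap,
      Complex.ofReal_inv]
    rw [mul_inv_cancel_left₀ (hb _)]

lemma aeval_orthoQ_eq (z : ℂ) (n : ℕ) :
    aeval z (orthoQ (birthDeathA lam mu) (birthDeathB lam mu) n) =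
      -(signedRoot lam mu n *
        (stringSol (potential lam mu) (stringLength lam mu) 0 1 z n).1) := by
  have hb : ∀ n, (birthDeathB lam mu n : ℂ) ≠ 0 := fun n =>
    Complex.ofReal_ne_zero.2 (birthDeathB_pos hlam hmu n).ne'
  have key := eq_signedRoot_mul_stringSol hlam hmu (k := -1) (y := 0) (w := 1) (z := z)
    (r := fun n => aeval z (orthoQ (birthDeathA lam mu) (birthDeathB lam mu) n)) ?_ ?_ ?_ n
  · rw [key, neg_one_mul]
  · simp [orthoQ]
  · have h := congrArg (fun x : ℝ => (x : ℂ)) (signedRoot_one_mul hlam hmu 1)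
    simp only [Complex.ofReal_mul, Complex.ofReal_neg, Complex.ofReal_inv,
      Complex.ofReal_one] at h
    simp only [orthoQ, stringSol, aeval_C, Complex.coe_algebraMap, Complex.ofReal_inv,
      Complex.real_smul, mul_zero, sub_zero, zero_add, h]
    ring
  · intro n
    simp only [orthoQ, map_mul, map_sub, aeval_X, aeval_C, Complex.coe_algebraMap,
      Complex.ofReal_inv]
    rw [mul_inv_cancel_left₀ (hb _)]

end

lemma stringSol_zero (m l : ℕ → ℝ) (y w : ℂ) (n : ℕ) :
    stringSol m l y w 0 n = (y + (∑ k ∈ Finset.range n, l k : ℝ) * w, w) := by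
  induction n with
  | zero => simp [stringSol]
  | succ n ih =>
    simp [stringSol, ih, Finset.sum_range_succ]
    ring

lemma summable_of_le_rpow_neg {u : ℕ → ℝ} {M s : ℝ} (hs : 1 < s) (hu : ∀ n, 0 ≤ u n)
    (huM : ∀ n : ℕ, u n ≤ M * ((n : ℝ) + 1) ^ (-s)) : Summable u := by
  refine Summable.of_nonneg_of_le hu huM (Summable.mul_left M ?_)
  have := (summable_nat_add_iff 1).2 (Real.summable_nat_rpow.2 (by linarith : -s < -1))
  simpa using this

/-- The order of the Nevanlinna matrix of a birth and death process with power-like potential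
coefficients and string lengths. -/
theorem hasNevanlinnaOrder_birthDeath (hlam : ∀ n, 0 < lam n) (hmu : ∀ n, 0 < mu (n + 1))
    (hmu0 : mu 0 = 0) {α β M κ : ℝ} (hα : 1 < α) (hβ : 1 < β)
    (hπM : ∀ n : ℕ, potential lam mu n ≤ M * ((n : ℝ) + 1) ^ (-β))
    (hlM : ∀ n : ℕ, stringLength lam mu n ≤ M * ((n : ℝ) + 1) ^ (-α)) (hκ : 0 < κ)
    (hπκ : ∀ n : ℕ, κ * ((n : ℝ) + 1) ^ (-β) ≤ potential lam mu n)
    (hlam_le : ∀ n : ℕ, κ * ((n : ℝ) + 1) ^ (-(α + β)) ≤ (lam n)⁻¹) :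
    HasNevanlinnaOrder (birthDeathA lam mu) (birthDeathB lam mu) (1 / (α + β)) := by
  have hπ0 : ∀ n, 0 ≤ potential lam mu n := fun n => (potential_pos hlam hmu n).le
  have hl0 : ∀ n, 0 ≤ stringLength lam mu n := fun n => (stringLength_pos hlam hmu n).le
  have hπs := summable_of_le_rpow_neg hβ hπ0 hπM
  have hls := summable_of_le_rpow_neg hα hl0 hlM
  obtain ⟨C, -, hbound⟩ := exists_norm_stringSol_le hα hβ hπ0 hl0 hπM hlM
  have hsq : ∀ y w z : ℂ, Summable fun n => ‖(signedRoot lam mu n : ℂ) *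
      (stringSol (potential lam mu) (stringLength lam mu) y w z n).1‖ ^ 2 := by
    intro y w z
    have hr : 1 ≤ ‖z‖ + 1 := by linarith [norm_nonneg z]
    have h := hbound y w z (‖z‖ + 1) hr (by linarith)
    refine Summable.of_nonneg_of_le (fun n => by positivity) (fun n => ?_)
      (hπs.mul_right (((‖y‖ + ‖w‖) * Real.exp (((‖z‖ + 1) ^ (1 / (α + β)) + 1) *
        (C + Real.log (‖z‖ + 1)))) ^ 2))
    rw [norm_mul, mul_pow, Complex.norm_real, Real.norm_eq_abs, sq_abs, signedRoot_sq hlam hmu]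
    have := hπ0 n
    gcongr
    exact h n
  -- Mass times length is 1/λ_n, so the growth of λ_n alone controls the lower bound.
  have hml : ∀ n : ℕ, κ * ((n : ℝ) + 1) ^ (-(α + β)) ≤
      stringLength lam mu n * potential lam mu n := fun n => by
    have : stringLength lam mu n * potential lam mu n = (lam n)⁻¹ := by
      rw [stringLength, mul_inv, mul_assoc, inv_mul_cancel₀ (potential_pos hlam hmu n).ne', mul_one]
    rw [this]
    exact hlam_le n
  set L : ℕ → ℝ := fun n => ∑ k ∈ Finset.range n, stringLength lam mu k with hL
  have hL0 : ∀ n, 0 ≤ L n := fun n => Finset.sum_nonneg fun k _ => hl0 k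
  have hL1 : ∀ n, stringLength lam mu 0 ≤ L (n + 1) := fun n =>
    Finset.single_le_sum (fun k _ => hl0 k) (Finset.mem_range.2 (Nat.succ_pos n))
  have hw1 : Summable fun n => potential lam mu n * L n := by
    refine Summable.of_nonneg_of_le (fun n => mul_nonneg (hπ0 n) (hL0 n)) (fun n => ?_)
      (hπs.mul_right (∑' k, stringLength lam mu k))
    exact mul_le_mul_of_nonneg_left (hls.sum_le_tsum _ fun k _ => hl0 k) (hπ0 n)
  -- For A and B the weights are π_n L_n with L_0 = 0; from index 1 on, L_n is at least the first
  -- length.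
  set κ' := κ * min 1 (stringLength lam mu 0) with hκ'
  have hl00 := stringLength_pos hlam hmu 0
  have hκ'0 : 0 < κ' := mul_pos hκ (lt_min one_pos hl00)
  have hκ'κ : κ' ≤ κ := mul_le_of_le_one_right hκ.le (min_le_left _ _)
  have hml' : ∀ n : ℕ, κ' * ((n : ℝ) + 1) ^ (-(α + β)) ≤
      stringLength lam mu n * potential lam mu n := fun n => by
    refine le_trans ?_ (hml n)
    gcongr
  have hwκ' : ∀ n : ℕ, κ' * (((n + 1 : ℕ) : ℝ) + 1) ^ (-β) ≤
      potential lam mu (n + 1) * L (n + 1) := fun n => by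
    calc κ' * (((n + 1 : ℕ) : ℝ) + 1) ^ (-β)
        = κ * (((n + 1 : ℕ) : ℝ) + 1) ^ (-β) * min 1 (stringLength lam mu 0) := by
          rw [hκ']; ring
      _ ≤ _ := mul_le_mul (hπκ (n + 1)) ((min_le_right _ _).trans (hL1 n))
          (lt_min one_pos hl00).le (hπ0 _)
  have hP := aeval_orthoP_eq hlam hmu hmu0
  have hQ := aeval_orthoQ_eq hlam hmu
  have hP0 : ∀ n, aeval (0 : ℂ) (orthoP (birthDeathA lam mu) (birthDeathB lam mu) n) =
      signedRoot lam mu n := fun n => by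
    rw [hP, stringSol_zero]; simp
  have hQ0 : ∀ n, aeval (0 : ℂ) (orthoQ (birthDeathA lam mu) (birthDeathB lam mu) n) =
      -(signedRoot lam mu n * (L n : ℂ)) := fun n => by
    rw [hQ, stringSol_zero]; simp [hL]
  have hsqC : ∀ n, (signedRoot lam mu n : ℂ) * signedRoot lam mu n = potential lam mu n :=
    fun n => by rw [← Complex.ofReal_mul, ← sq, signedRoot_sq hlam hmu]
  refine ⟨fun z => ?_, fun z => ?_, ?_⟩
  · simpa only [hP] using hsq 1 0 z
  · simpa only [hQ, norm_neg] using hsq 0 1 z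
  · intro f hf
    simp only [Set.mem_insert_iff, Set.mem_singleton_iff] at hf
    rcases hf with rfl | rfl | rfl | rfl
    · refine entireOrder_string_series (y := 0) (v := 1) (c := 0) (σ := 1) hα hβ hπ0 hl0 hπM hlM
        hκ'0 hml' (fun n => mul_nonneg (hπ0 n) (hL0 n)) hw1 hwκ' le_rfl zero_le_one
        (by simpa using hl00) (by simp) (by simp) fun z => ?_
      rw [nevanlinnaA, zero_add, one_mul]
      congr 2; ext n
      rw [hQ0, hQ, Complex.ofReal_mul, ← hsqC, Complex.ofReal_zero, Complex.ofReal_one]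
      ring
    · refine entireOrder_string_series (y := 1) (v := 0) (c := -1) (σ := -1) hα hβ hπ0 hl0 hπM hlM
        hκ'0 hml' (fun n => mul_nonneg (hπ0 n) (hL0 n)) hw1 hwκ' zero_le_one le_rfl
        (by simp) (by simp) (by simp) fun z => ?_
      rw [nevanlinnaB, mul_left_comm, neg_one_mul, ← tsum_neg]
      congr 3; ext n
      rw [hQ0, hP, Complex.ofReal_mul, ← hsqC, Complex.ofReal_zero, Complex.ofReal_one]
      ring
    · refine entireOrder_string_series (y := 0) (v := 1) (c := 1) (σ := -1) hα hβ hπ0 hl0 hπM hlM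
        hκ hml hπ0 hπs (fun n => hπκ (n + 1)) le_rfl zero_le_one
        (by simpa using hl00) (by simp) (by simp) fun z => ?_
      rw [nevanlinnaC, mul_left_comm, neg_one_mul, ← tsum_neg]
      congr 3; ext n
      rw [hP0, hQ, ← hsqC, Complex.ofReal_zero, Complex.ofReal_one]
      ring
    · refine entireOrder_string_series (y := 1) (v := 0) (c := 0) (σ := 1) hα hβ hπ0 hl0 hπM hlM
        hκ hml hπ0 hπs (fun n => hπκ (n + 1)) zero_le_one le_rfl
        (by simp) (by simp) (by simp) fun z => ?_
      rw [nevanlinnaD, zero_add, one_mul]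
      congr 2; ext n
      rw [hP0, hP, ← hsqC, Complex.ofReal_zero, Complex.ofReal_one]
      ring

end BirthDeath

/-! ### Power asymptotics of the rates and potential coefficients. -/

section PowerAsymptotics

lemma exists_bounds_of_tendsto_pos {u : ℕ → ℝ} (hu : ∀ n, 0 < u n) {L : ℝ} (hL : 0 < L)
    (h : Tendsto u atTop (nhds L)) : ∃ c C, 0 < c ∧ ∀ n, c ≤ u n ∧ u n ≤ C := by
  obtain ⟨C, hC⟩ := h.bddAbove_range
  obtain ⟨c, hc⟩ := (h.inv₀ hL.ne').bddAbove_range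
  have hc' : ∀ n, (u n)⁻¹ ≤ c := fun n => hc ⟨n, rfl⟩
  have hc0 : 0 < c := (inv_pos.2 (hu 0)).trans_le (hc' 0)
  exact ⟨c⁻¹, C, inv_pos.2 hc0, fun n => ⟨inv_le_of_inv_le₀ (hu n) (hc' n), hC ⟨n, rfl⟩⟩⟩

/-- A quotient of Pochhammer symbols behaves like a power. -/
lemma exists_prod_div_bounds {x y : ℝ} (hx : 0 < x) (hy : 0 < y) :
    ∃ c C, 0 < c ∧ ∀ n : ℕ,
      c * ((n : ℝ) + 1) ^ (x - y) ≤ ∏ k ∈ Finset.range n, (k + x) / (k + y) ∧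
      ∏ k ∈ Finset.range n, (k + x) / (k + y) ≤ C * ((n : ℝ) + 1) ^ (x - y) := by
  have hpos : ∀ n : ℕ, 0 < ∏ k ∈ Finset.range n, (k + x) / (k + y) := fun n =>
    Finset.prod_pos fun k _ => by positivity
  have hp : ∀ n : ℕ, 0 < ((n : ℝ) + 1) ^ (x - y) := fun n => by positivity
  have hG : Tendsto (fun n => Real.GammaSeq y n / Real.GammaSeq x n) atTop
      (nhds (Real.Gamma y / Real.Gamma x)) :=
    (Real.GammaSeq_tendsto_Gamma y).div (Real.GammaSeq_tendsto_Gamma x)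
      (Real.Gamma_pos_of_pos hx).ne'
  have hR : Tendsto (fun n : ℕ => ((n : ℝ) / (n + 2)) ^ (x - y)) atTop (nhds 1) := by
    have := (tendsto_natCast_div_add_atTop (2 : ℝ)).rpow_const (p := x - y) (Or.inl one_ne_zero)
    simpa using this
  have hlim : Tendsto (fun n : ℕ => (∏ k ∈ Finset.range n, (k + x) / (k + y)) /
      ((n : ℝ) + 1) ^ (x - y)) atTop (nhds (Real.Gamma y / Real.Gamma x)) := by
    -- `Real.GammaSeq` at n has n + 1 factors in its denominator, hence the shift; the limit `hR`
    -- replaces n by n + 2 in the power.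
    rw [← tendsto_add_atTop_iff_nat 1]
    have h := hG.mul hR
    rw [mul_one] at h
    refine h.congr' ?_
    filter_upwards [eventually_gt_atTop 0] with n hn
    have hn0 : (0 : ℝ) < n := by exact_mod_cast hn
    have hf : (0 : ℝ) < (n.factorial : ℝ) := by exact_mod_cast n.factorial_pos
    have hxp : 0 < ∏ j ∈ Finset.range (n + 1), (x + (j : ℝ)) :=
      Finset.prod_pos fun k _ => by positivity
    have hyp : 0 < ∏ j ∈ Finset.range (n + 1), (y + (j : ℝ)) :=
      Finset.prod_pos fun k _ => by positivity
    have hn2 : ((n + 1 : ℕ) : ℝ) + 1 = n + 2 := by push_cast; ring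
    rw [hn2, Real.div_rpow hn0.le (by positivity), Real.rpow_sub hn0, Real.GammaSeq,
      Real.GammaSeq, Finset.prod_div_distrib]
    simp only [add_comm _ x, add_comm _ y]
    have h1 : 0 < (n : ℝ) ^ x := by positivity
    have h2 : 0 < (n : ℝ) ^ y := by positivity
    have h3 : 0 < ((n : ℝ) + 2) ^ (x - y) := by positivity
    field_simp
  obtain ⟨c, C, hc, h⟩ := exists_bounds_of_tendsto_pos (fun n => div_pos (hpos n) (hp n))
    (div_pos (Real.Gamma_pos_of_pos hy) (Real.Gamma_pos_of_pos hx)) hlim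
  exact ⟨c, C, hc, fun n => ⟨(le_div_iff₀ (hp n)).1 (h n).1, (div_le_iff₀ (hp n)).1 (h n).2⟩⟩

lemma polyRate_bounds {p : ℕ} (hp : 0 < p) {e : Fin p → ℝ} (he : ∀ j, 0 < e j) :
    ∃ c C, 0 < c ∧ ∀ n : ℕ, c * ((n : ℝ) + 1) ^ (p : ℝ) ≤ polyRate p e n ∧
      polyRate p e n ≤ C * ((n : ℝ) + 1) ^ (p : ℝ) := by
  have hp0 : (0 : ℝ) < p := by exact_mod_cast hp
  refine ⟨∏ j, min (p : ℝ) (e j), ∏ j, ((p : ℝ) + e j),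
    Finset.prod_pos fun j _ => lt_min hp0 (he j), fun n => ?_⟩
  have hconst : ((n : ℝ) + 1) ^ (p : ℝ) = ∏ _j : Fin p, ((n : ℝ) + 1) := by
    rw [Real.rpow_natCast, Finset.prod_const, Finset.card_univ, Fintype.card_fin]
  rw [hconst, ← Finset.prod_mul_distrib, ← Finset.prod_mul_distrib, polyRate]
  have hn : (0 : ℝ) ≤ n := n.cast_nonneg
  constructor
  · refine Finset.prod_le_prod (fun j _ => ?_) fun j _ => ?_
    · have := (lt_min hp0 (he j)).le
      positivity
    · rw [mul_add, mul_one]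
      gcongr
      · exact min_le_left _ _
      · exact min_le_right _ _
  · refine Finset.prod_le_prod (fun j _ => ?_) fun j _ => ?_
    · have := he j
      positivity
    · nlinarith [he j, mul_nonneg (he j).le hn]

/-- Taking p out of each linear factor splits π_n into p Pochhammer quotients with parameters e_j/p
and 1 + d_j/p, the 1 coming from the index shift in μ_{k+1}. The exponents add up, and d_j > -p
makes the parameters positive. -/
lemma potential_polyRate_bounds {p : ℕ} (hp : 0 < p) {e d : Fin p → ℝ} (he : ∀ j, 0 < e j)
    (hd : ∀ j, -(p : ℝ) < d j) :
    ∃ c C, 0 < c ∧ ∀ n : ℕ,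
      c * ((n : ℝ) + 1) ^ ((∑ j, e j - ∑ j, d j) / p - p) ≤
        potential (polyRate p e) (polyRate p d) n ∧
      potential (polyRate p e) (polyRate p d) n ≤
        C * ((n : ℝ) + 1) ^ ((∑ j, e j - ∑ j, d j) / p - p) := by
  have hp0 : (0 : ℝ) < p := by exact_mod_cast hp
  have hx : ∀ j, 0 < e j / p := fun j => div_pos (he j) hp0
  have hy : ∀ j, 0 < 1 + d j / p := fun j => by
    have : (1 : ℝ) + d j / p = (p + d j) / p := by field_simp
    rw [this]
    exact div_pos (by linarith [hd j]) hp0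
  choose c C hc h using fun j => exists_prod_div_bounds (hx j) (hy j)
  have hsum : (∑ j, e j - ∑ j, d j) / (p : ℝ) - p = ∑ j, (e j / p - (1 + d j / p)) := by
    rw [Finset.sum_sub_distrib, Finset.sum_add_distrib, ← Finset.sum_div, ← Finset.sum_div,
      Finset.sum_const, Finset.card_univ, Fintype.card_fin, nsmul_eq_mul, mul_one]
    ring
  have hpow : ∀ n : ℕ, ((n : ℝ) + 1) ^ ((∑ j, e j - ∑ j, d j) / (p : ℝ) - p) =
      ∏ j, ((n : ℝ) + 1) ^ (e j / p - (1 + d j / p)) := fun n => by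
    rw [hsum, Real.rpow_sum_of_pos (by positivity)]
  have hpot : ∀ n : ℕ, potential (polyRate p e) (polyRate p d) n =
      ∏ j, ∏ k ∈ Finset.range n, ((k : ℝ) + e j / p) / (k + (1 + d j / p)) := fun n => by
    rw [potential, Finset.prod_comm]
    refine Finset.prod_congr rfl fun k _ => ?_
    rw [polyRate, polyRate, ← Finset.prod_div_distrib]
    refine Finset.prod_congr rfl fun j _ => ?_
    have h1 : (p : ℝ) * k + e j = p * (k + e j / p) := by field_simp
    have h2 : (p : ℝ) * (k + 1 : ℕ) + d j = p * (k + (1 + d j / p)) := by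
      push_cast; field_simp; ring
    rw [h1, h2, mul_div_mul_left _ _ hp0.ne']
  refine ⟨∏ j, c j, ∏ j, C j, Finset.prod_pos fun j _ => hc j, fun n => ?_⟩
  rw [hpow, hpot, ← Finset.prod_mul_distrib, ← Finset.prod_mul_distrib]
  have hn : ∀ j, 0 < ((n : ℝ) + 1) ^ (e j / p - (1 + d j / p)) := fun j => by positivity
  have h0 : ∀ j, 0 ≤ c j * ((n : ℝ) + 1) ^ (e j / p - (1 + d j / p)) := fun j =>
    (mul_pos (hc j) (hn j)).le
  exact ⟨Finset.prod_le_prod (fun j _ => h0 j) fun j _ => (h j n).1,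
    Finset.prod_le_prod (fun j _ => (h0 j).trans (h j n).1) fun j _ => (h j n).2⟩

end PowerAsymptotics

/-! ### The polynomial rates: α + β = p. -/

theorem mainTheorem2 (p : ℕ) (e d : Fin p → ℝ)
    (he : ∀ j, 0 < e j) (hd : ∀ j, -(p : ℝ) < d j) (hd0 : ∏ j, d j = 0)
    (hlow : 1 < (∑ j, e j - ∑ j, d j) / (p : ℝ))
    (hupp : (∑ j, e j - ∑ j, d j) / (p : ℝ) < (p : ℝ) - 1) :
    IsIndeterminateStieltjes
        (birthDeathA (polyRate p e) (polyRate p d)) (birthDeathB (polyRate p e) (polyRate p d)) ∧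
      HasNevanlinnaOrder
        (birthDeathA (polyRate p e) (polyRate p d)) (birthDeathB (polyRate p e) (polyRate p d))
        (1 / (p : ℝ)) := by
  have hp0 : (0 : ℝ) < p := by linarith
  have hp : 0 < p := by exact_mod_cast hp0
  have hlam : ∀ n, 0 < polyRate p e n := fun n => Finset.prod_pos fun j _ => by
    have := he j
    positivity
  have hmu : ∀ n, 0 < polyRate p d (n + 1) := fun n => Finset.prod_pos fun j _ => by
    have h1 := hd j
    have h2 : (0 : ℝ) ≤ p * n := by positivity
    push_cast
    linarith
  have hmu0 : polyRate p d 0 = 0 := by simpa [polyRate] using hd0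
  obtain ⟨c₁, C₁, hc₁, h₁⟩ := polyRate_bounds hp he
  obtain ⟨c₂, C₂, hc₂, h₂⟩ := potential_polyRate_bounds hp he hd
  set α := (∑ j, e j - ∑ j, d j) / (p : ℝ) with hα
  set β := (p : ℝ) - α with hβ
  have hαp : α - p = -β := by ring
  rw [hαp] at h₂
  have hβ1 : 1 < β := by linarith
  have hn : ∀ n : ℕ, (0 : ℝ) < (n : ℝ) + 1 := fun n => by positivity
  have hlen : ∀ n : ℕ, stringLength (polyRate p e) (polyRate p d) n ≤
      (c₁ * c₂)⁻¹ * ((n : ℝ) + 1) ^ (-α) := fun n => by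
    have h3 : 0 < (c₁ * ((n : ℝ) + 1) ^ (p : ℝ)) * (c₂ * ((n : ℝ) + 1) ^ (-β)) := by
      have := hn n
      positivity
    have h4 : (c₁ * c₂)⁻¹ * ((n : ℝ) + 1) ^ (-α) =
        ((c₁ * ((n : ℝ) + 1) ^ (p : ℝ)) * (c₂ * ((n : ℝ) + 1) ^ (-β)))⁻¹ := by
      rw [mul_mul_mul_comm, ← Real.rpow_add (hn n), mul_inv (c₁ * c₂), ← Real.rpow_neg (hn n).le]
      congr 2
      rw [hβ]; ring
    rw [h4, stringLength]
    refine inv_anti₀ h3 (mul_le_mul (h₁ n).1 (h₂ n).1 ?_ (hlam n).le)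
    have := hn n
    positivity
  set M := max C₂ (c₁ * c₂)⁻¹
  have hC₁ : 0 < C₁ := by
    have := (hlam 0).trans_le (h₁ 0).2
    simpa using this
  have hM1 : ∀ n : ℕ, potential (polyRate p e) (polyRate p d) n ≤ M * ((n : ℝ) + 1) ^ (-β) :=
    fun n => (h₂ n).2.trans (mul_le_mul_of_nonneg_right (le_max_left _ _) (by positivity))
  have hM2 : ∀ n : ℕ, stringLength (polyRate p e) (polyRate p d) n ≤
      M * ((n : ℝ) + 1) ^ (-α) :=
    fun n => (hlen n).trans (mul_le_mul_of_nonneg_right (le_max_right _ _) (by positivity))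
  refine ⟨isIndeterminateStieltjes_birthDeath hlam hmu hmu0
    (summable_of_le_rpow_neg hβ1 (fun n => (potential_pos hlam hmu n).le) hM1)
    (summable_of_le_rpow_neg hlow (fun n => (stringLength_pos hlam hmu n).le) hM2), ?_⟩
  have hαβ : (p : ℝ) = α + β := by rw [hβ]; ring
  have hκ : 0 < min c₂ C₁⁻¹ := lt_min hc₂ (inv_pos.2 hC₁)
  have key := hasNevanlinnaOrder_birthDeath hlam hmu hmu0 (κ := min c₂ C₁⁻¹) hlow hβ1 hM1 hM2 hκ
    (fun n => le_trans (mul_le_mul_of_nonneg_right (min_le_left _ _) (by positivity)) (h₂ n).1)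
    fun n => ?_
  · rwa [← hαβ] at key
  · refine le_trans (mul_le_mul_of_nonneg_right (min_le_right _ _) (by positivity)) ?_
    rw [Real.rpow_neg (hn n).le, ← mul_inv, ← hαβ]
    exact inv_anti₀ (hlam n) (h₁ n).2
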